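/- A linkage is a loopless multigraph with vertex set $V$ and edge set $E$ together with a length function $l : E \to \mathbb R_{\ge 0}$. Its configuration space $C(L)$ is the set of all $p : V \to \mathbb R^2$ with $|p(u)-p(v)| = l(e)$ for every edge $e$ with end points $u, v$, as a subspace of $(\mathbb R^2)^V$; its moduli space $M(L)$ is the orbit space of $C(L)$ under the action of the group of orientation preserving isometries of $\mathbb R^2$, with the quotient topology. Let $P$ be a path linkage with $k \ge 2$ edges, all of positive length, and let $s$ and $t$ be the two end vertices of the path. Let $\theta(p) = |p(s)-p(t)|$ for $p \in M(P)$, and let $[P] = \theta(M(P)) \subset \mathbb R$, so that $\theta : M(P) \to [P]$. Let $$\nabla(P) = \{x \in [P] : \theta^{-1}(x) \text{ is connected}\}.$$ Call $p \in M(P)$ a critical point of $\theta$ if $\theta(p) = 0$ or the derivative of $\theta$ on the smooth manifold $M(P)$ vanishes at $p$, that is, $\theta$ has derivative $0$ at time $0$ along every smooth curve in $C(P)$ that represents $p$ at time $0$; the critical values of $\theta$ are its values at critical points. Let $p, q \in M(P)$ be such that neither $\theta(p)$ nor $\theta(q)$ is a critical value of $\theta$. Let $\alpha : [0,1] \to [P]$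 be continuous with $\alpha(0) = \theta(p)$ and $\alpha(1) = \theta(q)$, and suppose that $\alpha([0,1]) \cap \nabla(P) \neq \emptyset$. Then there is a continuous map $\tilde\alpha : [0,1] \to M(P)$ with $\tilde\alpha(0) = p$, $\tilde\alpha(1) = q$ and $\theta \circ \tilde\alpha = \alpha$. -/

import Mathlib

noncomputable section

open scoped ContDiff NNReal

/-- The group of orientation preserving isometries of the Euclidean plane (modelled by `ℂ` with its
usual Euclidean distance): the isometries whose linear part has positive determinant. -/
def planeMotions : Subgroup (ℂ ≃ᵃⁱ[ℝ] ℂ) where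
  carrier := {g | 0 < LinearMap.det (g.linearIsometryEquiv.toLinearEquiv : ℂ →ₗ[ℝ] ℂ)}
  one_mem' := by
    have h : ((1 : ℂ ≃ᵃⁱ[ℝ] ℂ).linearIsometryEquiv.toLinearEquiv : ℂ →ₗ[ℝ] ℂ) = LinearMap.id := rfl
    simp [h]
  mul_mem' := by
    intro g h hg hh
    have e : ((g * h).linearIsometryEquiv.toLinearEquiv : ℂ →ₗ[ℝ] ℂ) =
        (g.linearIsometryEquiv.toLinearEquiv : ℂ →ₗ[ℝ] ℂ) ∘ₗ
          (h.linearIsometryEquiv.toLinearEquiv : ℂ →ₗ[ℝ] ℂ) := rfl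
    simp only [Set.mem_ofPred_eq] at hg hh ⊢
    rw [e, LinearMap.det_comp]
    exact mul_pos hg hh
  inv_mem' := by
    intro g hg
    have e : ((g⁻¹).linearIsometryEquiv.toLinearEquiv : ℂ →ₗ[ℝ] ℂ) =
        (g.linearIsometryEquiv.toLinearEquiv.symm : ℂ →ₗ[ℝ] ℂ) := rfl
    simp only [Set.mem_ofPred_eq] at hg ⊢
    rw [e]
    have h := LinearEquiv.det_symm_mul_det g.linearIsometryEquiv.toLinearEquiv
    by_contra hn
    nlinarith

/-- A linkage: a loopless multigraph with vertex set `V` and edges indexed by `E`, together with a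
nonnegative length for every edge. -/
structure Linkage (V E : Type*) where
  /-- The unordered pair of end points of an edge. -/
  ends : E → Sym2 V
  /-- There are no loops. -/
  not_isDiag : ∀ e, ¬ (ends e).IsDiag
  /-- The length function. -/
  length : E → ℝ≥0

namespace Linkage

variable {V E : Type*} (L : Linkage V E)

/-- `L` is a path linkage with `k` edges and terminal vertices `s` and `t`: its graph is isomorphic
to the path `0 - 1 - ⋯ - k`, with `s` and `t` corresponding to the end points `0` and `k`. -/
def IsPath (k : ℕ) (s t : V) : Prop :=
  ∃ (φ : Fin (k + 1) ≃ V) (ψ : Fin k ≃ E),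
    (∀ i : Fin k, L.ends (ψ i) = s(φ i.castSucc, φ i.succ)) ∧ φ 0 = s ∧ φ (Fin.last k) = t

/-- The space of planar configurations `C(L)`, with the topology inherited from the product
`V → ℂ`. -/
def Config : Type _ :=
  {p : V → ℂ // ∀ (e : E) (u v : V), L.ends e = s(u, v) → dist (p u) (p v) = L.length e}

instance : TopologicalSpace L.Config :=
  inferInstanceAs (TopologicalSpace
    {p : V → ℂ // ∀ (e : E) (u v : V), L.ends e = s(u, v) → dist (p u) (p v) = L.length e})

/-- Orientation preserving isometries act on configurations by composition. -/
instance : MulAction planeMotions L.Config where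
  smul g p := ⟨fun v => g.1 (p.1 v), fun e u v h => by
    rw [g.1.dist_map]; exact p.2 e u v h⟩
  one_smul _ := rfl
  mul_smul _ _ _ := rfl

/-- The moduli space `M(L)`: the orbit space of `C(L)` under orientation preserving isometries,
with the quotient topology. -/
def Moduli : Type _ := Quotient (MulAction.orbitRel planeMotions L.Config)

instance : TopologicalSpace L.Moduli :=
  inferInstanceAs (TopologicalSpace (Quotient (MulAction.orbitRel planeMotions L.Config)))

variable {L}

/-- The class in `M(L)` of a configuration. -/
def toModuli (p : L.Config) : L.Moduli :=
  Quotient.mk (MulAction.orbitRel planeMotions L.Config) p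

/-- The function `θ` on `M(L)`: the distance between the images of `s` and `t`. -/
def theta (s t : V) : L.Moduli → ℝ :=
  Quotient.lift (s := MulAction.orbitRel planeMotions L.Config)
    (fun p => dist (p.1 s) (p.1 t)) (by
      rintro p q ⟨g, rfl⟩
      exact g.1.dist_map _ _)

variable (L)

/-- The set `[L, s, t]` of values of `θ`. -/
def distSet (s t : V) : Set ℝ := {x | ∃ p : L.Moduli, theta s t p = x}

/-- The set `∇` of all `x ∈ [L, s, t]` over which the fibre of `θ` is connected. -/
def nabla (s t : V) : Set ℝ :=
  {x | x ∈ L.distSet s t ∧ IsConnected {p : L.Moduli | theta s t p = x}}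

variable {L}

/-- `p` is a critical point of `θ` if `θ(p) = 0` or the derivative of `θ` at `p` vanishes.
The latter is expressed through tangent vectors as velocities of curves: `θ` has derivative `0` at
time `0` along every smooth motion `γ` of the linkage whose configuration at time `0` represents
`p`. (For a path linkage with positive lengths, `C(L)` is a smooth submanifold of the space of all
maps `V → ℂ`, and `C(L) → M(L)` is a submersion onto the quotient manifold, so that the velocities
at time `0` of these motions represent exactly the tangent vectors of `M(L)` at `p`.) -/
def IsCriticalPoint (s t : V) (p : L.Moduli) : Prop :=
  theta s t p = 0 ∨
    ∀ γ : ℝ → L.Config, (∀ v : V, ContDiff ℝ ∞ (fun τ => (γ τ).1 v)) → toModuli (γ 0) = p →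
      HasDerivAt (fun τ => theta s t (toModuli (γ τ))) 0 0

variable (L)

/-- Critical values of `θ` are its values at critical points. -/
def IsCriticalValue (s t : V) (x : ℝ) : Prop :=
  ∃ p : L.Moduli, IsCriticalPoint s t p ∧ theta s t p = x

end Linkage

end

/-! Modulo translations a configuration of the path is a tuple of plane vectors of prescribed
lengths, and `M(P)` is the space of such tuples modulo a common rotation (`toModuli_eq_iff`); `θ` is
the norm of their sum.

Every path of attainable distances lifts from any initial position (`exists_isLift`). By induction
on the number of edges, one edge is detached, the distance spanned by the others is prescribed as a
positive continuous function compatible with the triangle inequalities, and the detached edge closes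
the triangle with a fixed orientation. What remains is to hit the end position, up to rotation. Let
`x` be a value of the path, at time `u`, whose fibre is connected.

If a collinear chain realises `x`, then `x` is a critical value (`isCriticalValue_of_collinear`), so
`u` is neither 0 nor 1. The lift can be steered to that collinear chain at time `u`
(`exists_joins_collinear`), both from `p` and, with time reversed, from `q`; after a rotation the
two motions fit together.

Otherwise no position over `x` is collinear. Near a non-collinear position two edges that are not
parallel can absorb any small change, so nearby positions are joined over every path of distances
close to `x` (`eventually_linked`). This relation is an equivalence, and connectedness of the fibre
spreads it over the whole fibre (`linked_of_isPreconnected`). Lifts from `p` and from `q` are then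
connected during a short time around `u` (`exists_joins_of_linked`). -/

namespace Linkage

open scoped Topology
open Complex Filter

/-! ### Triangles with prescribed side lengths -/

/-- Sixteen times the squared area of a triangle with side lengths `y`, `l`, `x`. -/
def heron (y l x : ℝ) : ℝ := 4 * y ^ 2 * l ^ 2 - (x ^ 2 - y ^ 2 - l ^ 2) ^ 2

/-- A vector of length `l` whose sum with `w` has length `x`; the sign `σ` selects the orientation
of the triangle. -/
noncomputable def triEdge (σ : ℝ) (w : ℂ) (l x : ℝ) : ℂ :=
  w * (((x ^ 2 - ‖w‖ ^ 2 - l ^ 2 : ℝ) : ℂ) + ((σ * √(heron ‖w‖ l x) : ℝ) : ℂ) * I) /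
    ((2 * ‖w‖ ^ 2 : ℝ) : ℂ)

lemma heron_nonneg {y l x : ℝ} (hy : 0 ≤ y) (hl : 0 ≤ l) (h1 : |y - l| ≤ x) (h2 : x ≤ y + l) :
    0 ≤ heron y l x := by
  have hx : 0 ≤ x := (abs_nonneg _).trans h1
  have e : heron y l x = ((y + l) ^ 2 - x ^ 2) * (x ^ 2 - (y - l) ^ 2) := by
    unfold heron; ring
  rw [e]
  apply mul_nonneg
  · nlinarith
  · have := sq_le_sq' (by linarith [neg_abs_le (y - l), abs_nonneg (y - l)]) h1
    rw [sq_abs] at this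
    linarith

lemma norm_sq_eq (z : ℂ) : ‖z‖ ^ 2 = z.re ^ 2 + z.im ^ 2 := by
  rw [Complex.sq_norm, Complex.normSq_apply]; ring

/-- Times the conjugate of `w`, the edge has real part `(x² - ‖w‖² - l²) / 2` by the law of cosines;
`heron` is what the squared modulus `‖w‖² l²` leaves for the imaginary part, up to sign and a factor
4. -/
lemma norm_triEdge {σ : ℝ} {w : ℂ} {l x : ℝ} (hσ : σ ^ 2 = 1) (hw : w ≠ 0) (hl : 0 ≤ l)
    (hB : 0 ≤ heron ‖w‖ l x) : ‖triEdge σ w l x‖ = l := by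
  have hw' : 0 < ‖w‖ := norm_pos_iff.2 hw
  rw [← sq_eq_sq₀ (norm_nonneg _) hl]
  have hs := Real.sq_sqrt hB
  set r := √(heron ‖w‖ l x)
  unfold triEdge
  rw [norm_div, norm_mul, div_pow, mul_pow, norm_sq_eq (_ + _), Complex.norm_real]
  have : (σ * r) ^ 2 = heron ‖w‖ l x := by rw [mul_pow, hσ, hs, one_mul]
  simp only [add_re, ofReal_re, mul_re, I_re, mul_zero, ofReal_im, I_im, mul_one, sub_self,
    add_zero, add_im, mul_im, zero_add]
  rw [this, heron, Real.norm_eq_abs, sq_abs]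
  field_simp
  ring

lemma norm_add_triEdge {σ : ℝ} {w : ℂ} {l x : ℝ} (hσ : σ ^ 2 = 1) (hw : w ≠ 0) (hl : 0 ≤ l)
    (hx : 0 ≤ x) (hB : 0 ≤ heron ‖w‖ l x) : ‖w + triEdge σ w l x‖ = x := by
  have hw' : 0 < ‖w‖ := norm_pos_iff.2 hw
  rw [← sq_eq_sq₀ (norm_nonneg _) hx]
  have h1 := norm_triEdge hσ hw hl hB
  have h2 : ‖w + triEdge σ w l x‖ ^ 2 =
      ‖w‖ ^ 2 + ‖triEdge σ w l x‖ ^ 2 + 2 * (triEdge σ w l x * (starRingEnd ℂ) w).re := by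
    rw [norm_sq_eq, norm_sq_eq, norm_sq_eq]
    simp only [add_re, add_im, mul_re, conj_re, conj_im]
    ring
  have h3 : triEdge σ w l x * (starRingEnd ℂ) w =
      (((x ^ 2 - ‖w‖ ^ 2 - l ^ 2) / 2 : ℝ) : ℂ) +
        ((σ * √(heron ‖w‖ l x) / 2 : ℝ) : ℂ) * I := by
    have hc : w * (starRingEnd ℂ) w = ((‖w‖ ^ 2 : ℝ) : ℂ) := by
      rw [Complex.mul_conj, Complex.sq_norm]
    have hn : (‖w‖ : ℂ) ≠ 0 := by exact_mod_cast hw'.ne'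
    unfold triEdge
    rw [div_mul_eq_mul_div, mul_right_comm, hc]
    push_cast
    field_simp
  rw [h2, h1, h3]
  simp only [add_re, ofReal_re, mul_re, I_re, mul_zero, ofReal_im, I_im, mul_one, sub_self,
    add_zero]
  ring

lemma norm_add_sq_sub (w e : ℂ) :
    ‖w + e‖ ^ 2 - ‖w‖ ^ 2 - ‖e‖ ^ 2 = 2 * (e * (starRingEnd ℂ) w).re := by
  rw [norm_sq_eq, norm_sq_eq, norm_sq_eq]
  simp only [add_re, add_im, mul_re, conj_re, conj_im]
  ring

lemma heron_norm (w e : ℂ) :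
    heron ‖w‖ ‖e‖ ‖w + e‖ = 4 * (e * (starRingEnd ℂ) w).im ^ 2 := by
  rw [heron, norm_add_sq_sub, norm_sq_eq, norm_sq_eq]
  simp only [mul_re, mul_im, conj_re, conj_im]
  ring

/-- The sides determine the triangle up to reflection, and `σ` records which one. Either sign serves
a degenerate triangle. -/
lemma eq_triEdge {σ : ℝ} {w e : ℂ} (hσ : σ ^ 2 = 1) (hw : w ≠ 0)
    (hs : 0 ≤ σ * (e * (starRingEnd ℂ) w).im) : e = triEdge σ w ‖e‖ ‖w + e‖ := by
  have hw' : 0 < ‖w‖ := norm_pos_iff.2 hw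
  have hn : (‖w‖ : ℂ) ≠ 0 := by exact_mod_cast hw'.ne'
  have hA := norm_add_sq_sub w e
  have hq : √(heron ‖w‖ ‖e‖ ‖w + e‖) = 2 * (σ * (e * (starRingEnd ℂ) w).im) := by
    have hB : heron ‖w‖ ‖e‖ ‖w + e‖ = (2 * (σ * (e * (starRingEnd ℂ) w).im)) ^ 2 := by
      rw [heron_norm, mul_pow _ (σ * _), mul_pow σ, hσ]; ring
    rw [hB, Real.sqrt_sq (by linarith)]
  unfold triEdge
  rw [hA, hq]
  have h4 : σ * (2 * (σ * (e * (starRingEnd ℂ) w).im)) = 2 * (e * (starRingEnd ℂ) w).im := by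
    calc _ = 2 * (σ ^ 2 * (e * (starRingEnd ℂ) w).im) := by ring
      _ = _ := by rw [hσ, one_mul]
  rw [h4]
  have h5 : ((2 * (e * (starRingEnd ℂ) w).re : ℝ) : ℂ) +
      ((2 * (e * (starRingEnd ℂ) w).im : ℝ) : ℂ) * I = 2 * (e * (starRingEnd ℂ) w) := by
    conv_rhs => rw [← Complex.re_add_im (e * (starRingEnd ℂ) w)]
    push_cast; ring
  have hc : w * (starRingEnd ℂ) w = ((‖w‖ ^ 2 : ℝ) : ℂ) := by
    rw [Complex.mul_conj, Complex.sq_norm]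
  rw [h5, show w * (2 * (e * (starRingEnd ℂ) w)) = 2 * e * (w * (starRingEnd ℂ) w) by ring, hc]
  push_cast
  field_simp

lemma continuous_triEdge (σ l : ℝ) {X : Type*} [TopologicalSpace X] {w : X → ℂ} {x : X → ℝ}
    (hw : Continuous w) (hx : Continuous x) (h0 : ∀ t, w t ≠ 0) :
    Continuous fun t => triEdge σ (w t) l (x t) := by
  unfold triEdge heron
  refine Continuous.div (by fun_prop) (by fun_prop) fun t => ?_
  have := h0 t
  norm_cast
  positivity

/-- The orientation is read off at time `a` and kept. Degenerate triangles do no harm, since the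
square root is continuous at 0; only `w = 0` would break continuity. -/
lemma exists_triEdge_path (l : ℝ) (hl : 0 ≤ l) {w : ℝ → ℂ} {x : ℝ → ℝ} (hw : Continuous w)
    (hx : Continuous x) (h0 : ∀ t, w t ≠ 0) (h1 : ∀ t, |‖w t‖ - l| ≤ x t)
    (h2 : ∀ t, x t ≤ ‖w t‖ + l) (a : ℝ) (e : ℂ) (he : ‖e‖ = l) (hea : ‖w a + e‖ = x a) :
    ∃ g : ℝ → ℂ, Continuous g ∧ (∀ t, ‖g t‖ = l) ∧ (∀ t, ‖w t + g t‖ = x t) ∧ g a = e := by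
  obtain ⟨σ, hσ, hs⟩ : ∃ σ : ℝ, σ ^ 2 = 1 ∧ 0 ≤ σ * (e * (starRingEnd ℂ) (w a)).im := by
    rcases le_total 0 (e * (starRingEnd ℂ) (w a)).im with h | h
    · exact ⟨1, by norm_num, by linarith⟩
    · exact ⟨-1, by norm_num, by linarith⟩
  have hB : ∀ t, 0 ≤ heron ‖w t‖ l (x t) := fun t => heron_nonneg (norm_nonneg _) hl (h1 t) (h2 t)
  refine ⟨_, continuous_triEdge σ l hw hx h0, fun t => norm_triEdge hσ (h0 t) hl (hB t),
    fun t => norm_add_triEdge hσ (h0 t) hl ((abs_nonneg _).trans (h1 t)) (hB t), ?_⟩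
  have := eq_triEdge hσ (h0 a) hs
  rw [he, hea] at this
  exact this.symm

/-! ### Chains of edge vectors and lifts of distance functions -/

section Chains

variable {ι : Type*}

/-- The family `e` of edge vectors has the lengths `l`. -/
def IsConf (l : ι → ℝ) (e : ι → ℂ) : Prop := ∀ j, ‖e j‖ = l j

/-- The set of end-to-end distances of the chains with edges `s`. -/
def ran (l : ι → ℝ) (s : Finset ι) : Set ℝ :=
  Set.image (fun e : ι → ℂ => ‖∑ j ∈ s, e j‖) {e | IsConf l e}

/-- `f` is a continuous motion along which the chain with edges `s` has end-to-end distance `α`. -/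
structure IsLift (l : ι → ℝ) (s : Finset ι) (α : ℝ → ℝ) (f : ℝ → ι → ℂ) : Prop where
  cont : Continuous f
  conf : ∀ t, IsConf l (f t)
  dist_eq : ∀ t, ‖∑ j ∈ s, f t j‖ = α t

variable {l : ι → ℝ}

/-- The positions form a product of circles, which is compact and connected. -/
lemma exists_ran_eq_Icc (hl : ∀ j, 0 < l j) (s : Finset ι) : ∃ m M, ran l s = Set.Icc m M := by
  have e : {e : ι → ℂ | IsConf l e} = Set.univ.pi fun j => Metric.sphere (0 : ℂ) (l j) := by
    ext e; simp [IsConf]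
  have hc : Continuous fun e : ι → ℂ => ‖∑ j ∈ s, e j‖ := by fun_prop
  have h1 : IsCompact (ran l s) := by
    unfold ran; rw [e]
    exact (isCompact_univ_pi fun j => isCompact_sphere _ _).image hc
  have h2 : IsConnected (ran l s) := by
    unfold ran; rw [e]
    refine IsConnected.image (isConnected_univ_pi.2 fun j => isConnected_sphere ?_ _ (hl j).le) _
      hc.continuousOn
    rw [Complex.rank_real_complex]; norm_num
  exact ⟨_, _, eq_Icc_of_connected_compact h2 h1⟩

lemma IsConf.mem_ran {e : ι → ℂ} (he : IsConf l e) (s : Finset ι) : ‖∑ j ∈ s, e j‖ ∈ ran l s :=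
  ⟨e, he, rfl⟩

lemma exists_pos_mem_ran (hl : ∀ j, 0 < l j) {s : Finset ι} (hs : s.Nonempty) :
    ∃ x ∈ ran l s, 0 < x := by
  have hc : IsConf l fun j => (l j : ℂ) := fun j => by
    rw [Complex.norm_real, Real.norm_of_nonneg (hl j).le]
  refine ⟨_, hc.mem_ran s, ?_⟩
  have := Finset.sum_pos (fun j (_ : j ∈ s) => hl j) hs
  rw [← Complex.ofReal_sum, Complex.norm_real]
  exact norm_pos_iff.2 this.ne'

variable [DecidableEq ι]

lemma IsConf.triangle {e : ι → ℂ} (he : IsConf l e) {s : Finset ι} {i : ι} (hi : i ∉ s) :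
    |‖∑ j ∈ s, e j‖ - l i| ≤ ‖∑ j ∈ insert i s, e j‖ ∧
      ‖∑ j ∈ insert i s, e j‖ ≤ ‖∑ j ∈ s, e j‖ + l i := by
  rw [Finset.sum_insert hi, ← he i]
  refine ⟨?_, ?_⟩
  · have := abs_norm_sub_norm_le (∑ j ∈ s, e j) (-e i)
    rwa [norm_neg, sub_neg_eq_add, add_comm (∑ j ∈ s, e j)] at this
  · rw [add_comm (e i)]; exact norm_add_le _ _

/-- The function `y` is `g` clamped to the distances that the chain `s` attains and that form a
triangle with `l i` and `α t`. This interval is nonempty because `α t` is attained, and its upper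
end is positive. The last clause allows values of `y` to be prescribed at chosen times. -/
lemma exists_admissible (hl : ∀ j, 0 < l j) {s : Finset ι} {i : ι} (hi : i ∉ s)
    (hs : s.Nonempty) {α g : ℝ → ℝ} (hα : Continuous α) (hr : ∀ t, α t ∈ ran l (insert i s))
    (hg : Continuous g) (hg0 : ∀ t, 0 < g t) :
    ∃ y : ℝ → ℝ, Continuous y ∧ (∀ t, 0 < y t) ∧ (∀ t, y t ∈ ran l s) ∧
      (∀ t, |y t - l i| ≤ α t) ∧ (∀ t, α t ≤ y t + l i) ∧
      ∀ t, g t ∈ ran l s → |g t - l i| ≤ α t → α t ≤ g t + l i → y t = g t := by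
  obtain ⟨m, M, hmM⟩ := exists_ran_eq_Icc hl s
  obtain ⟨x, hx, hx0⟩ := exists_pos_mem_ran hl hs
  have hM : 0 < M := by rw [hmM] at hx; exact hx0.trans_le hx.2
  have hle : ∀ t, max |α t - l i| m ≤ min (α t + l i) M := by
    intro t
    obtain ⟨e, he, het⟩ := hr t
    have h1 := he.triangle hi
    have h2 := he.mem_ran s
    simp only at het
    rw [het] at h1
    rw [hmM] at h2
    have h3 := abs_le.1 h1.1
    refine le_trans (b := ‖∑ j ∈ s, e j‖) ?_ ?_
    · exact max_le (abs_le.2 ⟨by linarith, by linarith⟩) h2.1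
    · exact le_min (by linarith) h2.2
  have hα0 : ∀ t, 0 ≤ α t := by
    intro t
    obtain ⟨e, -, het⟩ := hr t
    rw [← het]; exact norm_nonneg _
  refine ⟨fun t => max (max |α t - l i| m) (min (g t) (min (α t + l i) M)), by fun_prop,
    fun t => ?_, fun t => ?_, fun t => ?_, fun t => ?_, fun t h1 h2 h3 => ?_⟩
  · exact lt_max_of_lt_right (lt_min (hg0 t) (lt_min (by linarith [hl i, hα0 t]) hM))
  · rw [hmM]
    exact ⟨le_max_of_le_left (le_max_right _ _),
      max_le ((hle t).trans (min_le_right _ _)) ((min_le_right _ _).trans (min_le_right _ _))⟩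
  · have h1 : |α t - l i| ≤ max (max |α t - l i| m) (min (g t) (min (α t + l i) M)) :=
      le_max_of_le_left (le_max_left _ _)
    have h2 : max (max |α t - l i| m) (min (g t) (min (α t + l i) M)) ≤ α t + l i :=
      max_le ((hle t).trans (min_le_left _ _)) ((min_le_right _ _).trans (min_le_left _ _))
    have h3 := abs_le.1 h1
    exact abs_le.2 ⟨by linarith, by linarith⟩
  · have h1 : |α t - l i| ≤ max (max |α t - l i| m) (min (g t) (min (α t + l i) M)) :=
      le_max_of_le_left (le_max_left _ _)
    linarith [le_abs_self (α t - l i)]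
  · rw [hmM] at h1
    have h4 := abs_le.1 h2
    have h5 : |α t - l i| ≤ g t := abs_le.2 ⟨by linarith, by linarith⟩
    simp only
    rw [min_eq_left (le_min (by linarith) h1.2), max_eq_right (max_le h5 h1.1)]

lemma IsLift.exists_insert (hl : ∀ j, 0 < l j) {s : Finset ι} {i : ι} (hi : i ∉ s)
    {α y : ℝ → ℝ} (hα : Continuous α) (hy0 : ∀ t, 0 < y t) (h1 : ∀ t, |y t - l i| ≤ α t)
    (h2 : ∀ t, α t ≤ y t + l i) {f : ℝ → ι → ℂ} (hf : IsLift l s y f) {a : ℝ}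
    (hfa : ‖∑ j ∈ insert i s, f a j‖ = α a) :
    ∃ F, IsLift l (insert i s) α F ∧ F a = f a ∧ ∀ t, ∀ j ≠ i, F t j = f t j := by
  have hfc := hf.cont
  obtain ⟨g, hg, hgl, hgα, hga⟩ := exists_triEdge_path (l i) (hl i).le
    (w := fun t => ∑ j ∈ s, f t j) (x := α) (by fun_prop) hα
    (fun t => norm_pos_iff.1 (by rw [hf.dist_eq]; exact hy0 t))
    (fun t => by rw [hf.dist_eq]; exact h1 t) (fun t => by rw [hf.dist_eq]; exact h2 t) a (f a i)
    (hf.conf a i) (by rw [← hfa, Finset.sum_insert hi, add_comm])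
  refine ⟨fun t => Function.update (f t) i (g t), ⟨by fun_prop, fun t j => ?_, fun t => ?_⟩, ?_,
    fun t j hj => Function.update_of_ne hj _ _⟩
  · rcases eq_or_ne j i with rfl | hj
    · rw [Function.update_self, hgl]
    · rw [Function.update_of_ne hj, hf.conf t j]
  · rw [Finset.sum_insert hi, Function.update_self, Finset.sum_update_of_notMem hi, add_comm, hgα]
  · simp only [hga, Function.update_eq_self]

/-- If all these partial sums vanished, every edge would equal the total sum, so `n` equal nonzero
vectors would add up to one of them, forcing `n = 1`. -/
lemma exists_sum_erase_ne_zero {e : ι → ℂ} {s : Finset ι} (hs : s.Nontrivial)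
    (h0 : ∀ j ∈ s, e j ≠ 0) : ∃ i ∈ s, ∑ j ∈ s.erase i, e j ≠ 0 := by
  by_contra! h
  have h1 : ∀ i ∈ s, e i = ∑ j ∈ s, e j := fun i hi => by
    rw [← Finset.add_sum_erase s e hi, h i hi, add_zero]
  obtain ⟨i, hi⟩ := hs.nonempty
  have h2 : ∑ j ∈ s, e j = s.card * e i := by
    rw [Finset.sum_congr rfl fun j hj => (h1 j hj).trans (h1 i hi).symm, Finset.sum_const,
      nsmul_eq_mul]
  rw [← h1 i hi] at h2
  have h3 : ((s.card : ℂ) - 1) * e i = 0 := by linear_combination -h2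
  rcases mul_eq_zero.1 h3 with h4 | h4
  · have : s.card = 1 := by
      have : (s.card : ℂ) = 1 := by linear_combination h4
      exact_mod_cast this
    have := Finset.one_lt_card_iff_nontrivial.2 hs
    omega
  · exact h0 i hi h4

/-- Every continuous path of distances lifts to a motion of the chain, from any initial
position. -/
theorem exists_isLift (hl : ∀ j, 0 < l j) (s : Finset ι) (hs : s.Nonempty) {α : ℝ → ℝ}
    (hα : Continuous α) (hr : ∀ t, α t ∈ ran l s) (a : ℝ) {e : ι → ℂ} (he : IsConf l e)
    (hea : ‖∑ j ∈ s, e j‖ = α a) : ∃ f, IsLift l s α f ∧ f a = e := by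
  induction s using Finset.strongInduction generalizing α with
  | H s ih =>
    rcases hs.exists_eq_singleton_or_nontrivial with ⟨i, rfl⟩ | hnt
    -- A single edge attains only its own length, so `α` is constant.
    · refine ⟨fun _ => e, ⟨continuous_const, fun _ => he, fun t => ?_⟩, rfl⟩
      obtain ⟨e', he', h⟩ := hr t
      rw [← h]
      simp [he i, he' i]
    · obtain ⟨i, hi, hne⟩ := exists_sum_erase_ne_zero hnt
        (fun j _ => norm_pos_iff.1 ((he j).symm ▸ hl j))
      have hi' : i ∉ s.erase i := Finset.notMem_erase i s
      have hs' : (s.erase i).Nonempty := (Finset.erase_nonempty hi).2 hnt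
      have hins := Finset.insert_erase hi
      rw [← hins] at hr hea
      -- Clamping the constant initial distance leaves it unchanged at time `a`.
      obtain ⟨y, hy, hy0, hyr, hy1, hy2, hyg⟩ := exists_admissible hl hi' hs' hα hr
        (g := fun _ => ‖∑ j ∈ s.erase i, e j‖) continuous_const (fun _ => norm_pos_iff.2 hne)
      have htri := he.triangle hi'
      rw [hea] at htri
      obtain ⟨f, hf, hfa⟩ := ih _ (Finset.erase_ssubset hi) hs' hy hyr
        (hyg a (he.mem_ran _) htri.1 htri.2).symm
      obtain ⟨F, hF, hFa, -⟩ := hf.exists_insert hl hi' hα hy0 hy1 hy2 (a := a) (by rw [hfa, hea])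
      rw [hins] at hF
      exact ⟨F, hF, hFa.trans hfa⟩

end Chains

/-! ### Gluing motions and steering to collinear chains -/

section Joins

variable {ι : Type*} {l : ι → ℝ}

/-- Some motion over `α` is at `e` at time `a` and at `e'` at time `b`. -/
def Joins (l : ι → ℝ) (s : Finset ι) (α : ℝ → ℝ) (a : ℝ) (e : ι → ℂ) (b : ℝ) (e' : ι → ℂ) : Prop :=
  ∃ f, IsLift l s α f ∧ f a = e ∧ f b = e'

lemma IsLift.joins {s : Finset ι} {α : ℝ → ℝ} {f : ℝ → ι → ℂ} (hf : IsLift l s α f) (a b : ℝ) :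
    Joins l s α a (f a) b (f b) := ⟨f, hf, rfl, rfl⟩

lemma Joins.trans {s : Finset ι} {α : ℝ → ℝ} {a b c : ℝ} {e₁ e₂ e₃ : ι → ℂ}
    (h₁ : Joins l s α a e₁ b e₂) (h₂ : Joins l s α b e₂ c e₃) (hab : a ≤ b) (hbc : b ≤ c) :
    Joins l s α a e₁ c e₃ := by
  obtain ⟨f, hf, hfa, hfb⟩ := h₁
  obtain ⟨g, hg, hgb, hgc⟩ := h₂
  refine ⟨fun t => if t ≤ b then f t else g t, ⟨?_, fun t => ?_, fun t => ?_⟩, ?_, ?_⟩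
  · exact Continuous.if_le hf.cont hg.cont continuous_id continuous_const
      (fun t ht => by rw [show t = b from ht, hfb, hgb])
  · split_ifs
    exacts [hf.conf t, hg.conf t]
  · split_ifs
    exacts [hf.dist_eq t, hg.dist_eq t]
  · simp [hab, hfa]
  · rcases hbc.eq_or_lt with rfl | h
    · simp [hfb, ← hgc, hgb]
    · simp [h.not_ge, hgc]

lemma Joins.symm {s : Finset ι} {α : ℝ → ℝ} {a b : ℝ} {e e' : ι → ℂ}
    (h : Joins l s α a e b e') : Joins l s (fun t => α (-t)) (-b) e' (-a) e := by
  obtain ⟨f, hf, hfa, hfb⟩ := h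
  exact ⟨fun t => f (-t), ⟨hf.cont.comp continuous_neg, fun t => hf.conf _,
    fun t => hf.dist_eq _⟩, by simp [hfb], by simp [hfa]⟩

lemma Joins.rotate {s : Finset ι} {α : ℝ → ℝ} {a b : ℝ} {e e' : ι → ℂ}
    (h : Joins l s α a e b e') {ω : ℂ} (hω : ‖ω‖ = 1) : Joins l s α a (ω • e) b (ω • e') := by
  obtain ⟨f, hf, hfa, hfb⟩ := h
  refine ⟨fun t => ω • f t, ⟨hf.cont.const_smul ω, fun t j => ?_, fun t => ?_⟩, by simp [hfa],
    by simp [hfb]⟩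
  · simp [hω, hf.conf t j]
  · simp only [Pi.smul_apply]
    rw [← Finset.smul_sum, norm_smul, hω, one_mul, hf.dist_eq t]

variable [DecidableEq ι]

/-- Outside `[a, b]` the motion is continued by lifts through its two end positions. -/
lemma joins_of_Icc (hl : ∀ j, 0 < l j) {s : Finset ι} (hs : s.Nonempty) {α : ℝ → ℝ}
    (hα : Continuous α) (hr : ∀ t, α t ∈ ran l s) {a b : ℝ} (hab : a ≤ b) {f : ℝ → ι → ℂ}
    (hf : ContinuousOn f (Set.Icc a b)) (hc : ∀ t ∈ Set.Icc a b, IsConf l (f t))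
    (hd : ∀ t ∈ Set.Icc a b, ‖∑ j ∈ s, f t j‖ = α t) : Joins l s α a (f a) b (f b) := by
  have ha : a ∈ Set.Icc a b := ⟨le_rfl, hab⟩
  have hb : b ∈ Set.Icc a b := ⟨hab, le_rfl⟩
  have hm : ∀ t, (Set.projIcc a b hab t : ℝ) ∈ Set.Icc a b := fun t => (Set.projIcc a b hab t).2
  obtain ⟨g, hg, hga⟩ := exists_isLift hl s hs hα hr a (hc a ha) (hd a ha)
  obtain ⟨h, hh, hhb⟩ := exists_isLift hl s hs hα hr b (hc b hb) (hd b hb)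
  have hfc : Continuous fun t => f (Set.projIcc a b hab t) :=
    hf.comp_continuous (continuous_subtype_val.comp continuous_projIcc) hm
  refine ⟨fun t => if t ≤ a then g t else if t ≤ b then f (Set.projIcc a b hab t) else h t,
    ⟨?_, fun t => ?_, fun t => ?_⟩, ?_, ?_⟩
  · refine Continuous.if_le hg.cont ?_ continuous_id continuous_const ?_
    · refine Continuous.if_le hfc hh.cont continuous_id continuous_const ?_
      rintro t rfl
      simp [hhb]
    · rintro t rfl
      simp [hab, hga]
  · split_ifs
    exacts [hg.conf t, hc _ (hm t), hh.conf t]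
  · split_ifs with h1 h2
    · exact hg.dist_eq t
    · rw [hd _ (hm t), Set.projIcc_of_mem hab ⟨(not_le.1 h1).le, h2⟩]
    · exact hh.dist_eq t
  · simp [hga]
  · rcases hab.eq_or_lt with rfl | h
    · simp [hga]
    · simp [h.not_ge]

/-- Let `η` be the common direction of edges `i` and `k`. Edge `k` turns one way and the rest of
`s`, whose sum is `-η * l k`, turns by the same angle the other way, so that `s` sums to `-2 i η x`.
Edge `i` turns so that its component normal to `η` is `x`; the total is then its mirror image and
keeps norm `l i`. -/
lemma exists_open_closed_subchain (hl : ∀ j, 0 < l j) {s : Finset ι} {i k : ι} (hi : i ∉ s)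
    (hk : k ∈ s) {e : ι → ℂ} (he : IsConf l e) (h0 : ∑ j ∈ s, e j = 0)
    (hpar : e k * l i = e i * l k) :
    ∃ f : ℝ → ι → ℂ, Continuous f ∧ (∀ t, IsConf l (f t)) ∧
      (∀ t, ‖∑ j ∈ insert i s, f t j‖ = l i) ∧ f 0 = e ∧ ∑ j ∈ s, f 1 j ≠ 0 := by
  have hik : i ≠ k := fun h => hi (h ▸ hk)
  set μ := min (l i) (l k) with hμ
  have hμ0 : 0 < μ := lt_min (hl i) (hl k)
  have hli : (l i : ℂ) ≠ 0 := by exact_mod_cast (hl i).ne'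
  have hlk : (l k : ℂ) ≠ 0 := by exact_mod_cast (hl k).ne'
  set η : ℂ := e i / l i with hη
  have hη1 : ‖η‖ = 1 := by
    rw [hη, norm_div, he i, Complex.norm_real, Real.norm_of_nonneg (hl i).le, div_self (hl i).ne']
  have hei : e i = η * l i := by rw [hη]; field_simp
  have hek : e k = η * l k := by rw [hη]; field_simp; linear_combination hpar
  -- The normal displacement grows from 0 to `μ`, which is small enough to keep both square roots
  -- below real.
  set x : ℝ → ℝ := fun t => μ * max 0 (min 1 t) with hx
  have hxc : Continuous x := by fun_prop
  have hx0 : ∀ t, 0 ≤ x t := fun t => mul_nonneg hμ0.le (le_max_left _ _)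
  have hxμ : ∀ t, x t ≤ μ := fun t => by
    have : max 0 (min 1 t) ≤ 1 := max_le zero_le_one (min_le_left _ _)
    calc x t ≤ μ * 1 := mul_le_mul_of_nonneg_left this hμ0.le
      _ = μ := mul_one μ
  have hnorm : ∀ r : ℝ, 0 < r → μ ≤ r → ∀ σ : ℝ, σ ^ 2 = 1 → ∀ t,
      ‖((√(r ^ 2 - x t ^ 2) : ℝ) : ℂ) + ((σ * x t : ℝ) : ℂ) * I‖ = r := by
    intro r hr hμr σ hσ t
    rw [← sq_eq_sq₀ (norm_nonneg _) hr.le, norm_sq_eq]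
    have : 0 ≤ r ^ 2 - x t ^ 2 := by nlinarith [hx0 t, hxμ t]
    simp only [add_re, ofReal_re, mul_re, I_re, mul_zero, ofReal_im, I_im, mul_one, sub_self,
      add_zero, add_im, mul_im, zero_add]
    rw [Real.sq_sqrt this, mul_pow σ, hσ]
    ring
  set A : ℝ → ℝ → ℝ → ℂ := fun r σ t => ((√(r ^ 2 - x t ^ 2) : ℝ) : ℂ) + ((σ * x t : ℝ) : ℂ) * I
    with hA
  have hAc : ∀ r σ, Continuous (A r σ) := fun r σ => by fun_prop
  have hA0 : ∀ r, 0 < r → ∀ σ, A r σ 0 = r := fun r hr σ => by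
    simp [hA, hx, Real.sqrt_sq hr.le]
  set f : ℝ → ι → ℂ := fun t j => if j = i then η * A (l i) 1 t else
    if j = k then η * A (l k) (-1) t else if j ∈ s then A (l k) 1 t / l k * e j else e j with hf
  have hfi : ∀ t, f t i = η * A (l i) 1 t := fun t => by simp [hf]
  have hfk : ∀ t, f t k = η * A (l k) (-1) t := fun t => by simp [hf, hik.symm]
  have hfj : ∀ t, ∀ j ∈ s.erase k, f t j = A (l k) 1 t / l k * e j := by
    intro t j hj
    have h1 := Finset.ne_of_mem_erase hj
    have h2 := Finset.mem_of_mem_erase hj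
    have h3 : j ≠ i := fun h => hi (h ▸ h2)
    simp [hf, h1, h2, h3]
  have hrest : ∑ j ∈ s.erase k, e j = -(η * l k) := by
    rw [← Finset.add_sum_erase s e hk, hek] at h0
    linear_combination h0
  have hsum : ∀ t, ∑ j ∈ s, f t j = -2 * η * x t * I := by
    intro t
    rw [← Finset.add_sum_erase s (f t) hk, Finset.sum_congr rfl (hfj t), ← Finset.mul_sum, hrest,
      hfk]
    simp only [hA]
    field_simp
    push_cast
    ring
  refine ⟨f, ?_, fun t j => ?_, fun t => ?_, ?_, ?_⟩
  · refine continuous_pi fun j => ?_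
    simp only [hf]
    split_ifs <;> fun_prop
  · simp only [hf]
    split_ifs with h1 h2 h3
    · rw [norm_mul, hη1, one_mul, h1]
      exact hnorm _ (hl i) (min_le_left _ _) 1 (by norm_num) t
    · rw [norm_mul, hη1, one_mul, h2]
      exact hnorm _ (hl k) (min_le_right _ _) (-1) (by norm_num) t
    · rw [norm_mul, norm_div, he j, hnorm _ (hl k) (min_le_right _ _) 1 (by norm_num) t,
        Complex.norm_real, Real.norm_of_nonneg (hl k).le, div_self (hl k).ne', one_mul]
    · exact he j
  · rw [Finset.sum_insert hi, hsum, hfi,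
      show η * A (l i) 1 t + -2 * η * x t * I = η * A (l i) (-1) t by
        simp only [hA]; push_cast; ring, norm_mul, hη1, one_mul]
    exact hnorm _ (hl i) (min_le_left _ _) (-1) (by norm_num) t
  · funext j
    simp only [hf, hA0 _ (hl i), hA0 _ (hl k)]
    split_ifs with h1 h2 h3
    · rw [h1, hei]
    · rw [h2, hek]
    · field_simp
    · rfl
  · rw [hsum]
    have hη0 : η ≠ 0 := norm_pos_iff.1 (by rw [hη1]; norm_num)
    have : (x 1 : ℂ) ≠ 0 := by
      simp only [hx]; norm_num; exact hμ0.ne'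
    simp [hη0, this]

/-- If `s` is closed, the total distance is `l i`; so any time with another distance will do. If the
distance stays `l i`, a closed `s` is first rotated freely until edge `k` points along edge `i`, and
then opened by `exists_open_closed_subchain`. -/
lemma exists_joins_sum_ne_zero (hl : ∀ j, 0 < l j) {s : Finset ι} {i : ι} (hi : i ∉ s)
    (hs : s.Nonempty) {α : ℝ → ℝ} (hα : Continuous α) (hr : ∀ t, α t ∈ ran l (insert i s))
    {a b : ℝ} (hab : a < b) {e : ι → ℂ} (he : IsConf l e)
    (hea : ‖∑ j ∈ insert i s, e j‖ = α a) :
    ∃ c ∈ Set.Ico a b, ∃ e', IsConf l e' ∧ ‖∑ j ∈ insert i s, e' j‖ = α c ∧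
      Joins l (insert i s) α a e c e' ∧ ∑ j ∈ s, e' j ≠ 0 := by
  have hs' : (insert i s).Nonempty := Finset.insert_nonempty i s
  obtain ⟨f, hf, rfl⟩ := exists_isLift hl _ hs' hα hr a he hea
  by_cases hc : ∃ c ∈ Set.Ico a b, α c ≠ l i
  · obtain ⟨c, hc, hne⟩ := hc
    refine ⟨c, hc, f c, hf.conf c, hf.dist_eq c, hf.joins a c, fun h => hne ?_⟩
    rw [← hf.dist_eq c, Finset.sum_insert hi, h, add_zero, hf.conf c i]
  push Not at hc
  by_cases h0 : ∑ j ∈ s, f a j = 0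
  swap
  · exact ⟨a, ⟨le_rfl, hab⟩, f a, hf.conf a, hf.dist_eq a, hf.joins a a, h0⟩
  obtain ⟨k, hk⟩ := hs
  set e := f a
  have hli : (l i : ℂ) ≠ 0 := by exact_mod_cast (hl i).ne'
  have hlk : (l k : ℂ) ≠ 0 := by exact_mod_cast (hl k).ne'
  have hek : e k ≠ 0 := norm_pos_iff.1 (by rw [he k]; exact hl k)
  set ρ : ℂ := e i * l k / (e k * l i) with hρ
  have hρ1 : ‖ρ‖ = 1 := by
    rw [hρ, norm_div, norm_mul, norm_mul, Complex.norm_real, Complex.norm_real, he i, he k,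
      Real.norm_of_nonneg (hl k).le, Real.norm_of_nonneg (hl i).le, mul_comm]
    exact div_self (mul_pos (hl k) (hl i)).ne'
  set h : ℝ → ι → ℂ := fun t j => if j ∈ s then Complex.exp ((t * Complex.arg ρ : ℝ) * I) * e j
    else e j with hh
  have hhs : ∀ t, ∑ j ∈ s, h t j = 0 := by
    intro t
    rw [Finset.sum_congr rfl (g := fun j => Complex.exp ((t * Complex.arg ρ : ℝ) * I) * e j)
      (fun j hj => by simp [hh, hj]), ← Finset.mul_sum, h0, mul_zero]
  have hhc : ∀ t, IsConf l (h t) := fun t j => by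
    simp only [hh]
    split_ifs
    · rw [norm_mul, Complex.norm_exp_ofReal_mul_I, one_mul, he j]
    · exact he j
  have hhk : h 1 k = ρ * e k := by
    simp only [hh, hk, if_true, one_mul]
    conv_rhs => rw [← Complex.norm_mul_exp_arg_mul_I ρ, hρ1]
    simp
  have hhi : ∀ t, h t i = e i := fun t => by simp [hh, hi]
  obtain ⟨g, hg, hgc, hgd, hg0, hg1⟩ := exists_open_closed_subchain hl hi hk (hhc 1) (hhs 1)
    (by rw [hhk, hhi, hρ]; field_simp)
  -- Rotation and opening take one third of the time each, ending strictly before `b`.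
  set c := (2 * a + b) / 3 with hcdef
  set d := (a + 2 * b) / 3 with hddef
  have hac : a < c := by linarith
  have hcd : c < d := by linarith
  have hdb : d < b := by linarith
  have hα1 : ∀ t ∈ Set.Icc a d, α t = l i := fun t ht => hc t ⟨ht.1, ht.2.trans_lt hdb⟩
  have j1 : Joins l (insert i s) α a e c (h 1) := by
    have := joins_of_Icc hl hs' hα hr hac.le (f := fun t => h ((t - a) / (c - a)))
      (Continuous.continuousOn (by
        refine continuous_pi fun j => ?_
        simp only [hh]
        split_ifs <;> fun_prop)) (fun t _ => hhc _) (fun t ht => by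
        rw [Finset.sum_insert hi, hhs, hhi, add_zero, he i, hα1 t ⟨ht.1, ht.2.trans hcd.le⟩])
    have e0 : h 0 = e := by funext j; simp [hh]
    simpa [e0, (sub_pos.2 hac).ne'] using this
  have j2 : Joins l (insert i s) α c (h 1) d (g 1) := by
    have := joins_of_Icc hl hs' hα hr hcd.le (f := fun t => g ((t - c) / (d - c)))
      (Continuous.continuousOn (by fun_prop)) (fun t _ => hgc _) (fun t ht => by
        rw [hgd, hα1 t ⟨hac.le.trans ht.1, ht.2⟩])
    simpa [hg0, (sub_pos.2 hcd).ne'] using this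
  exact ⟨d, ⟨(hac.trans hcd).le, hdb⟩, g 1, hgc 1,
    by rw [hgd, hα1 d ⟨(hac.trans hcd).le, le_rfl⟩], j1.trans j2 hac.le hcd.le, hg1⟩

/-- A degenerate triangle is rigid: its sides determine the last edge, with no choice of
orientation. -/
lemma eq_of_norm_add_eq {r c : ℝ} {ω z : ℂ} (hω : ‖ω‖ = 1) (hr : r ≠ 0) (hz : ‖z‖ = |c|)
    (h : ‖ω * r + z‖ = |r + c|) : z = ω * c := by
  have hω0 : ω ≠ 0 := norm_pos_iff.1 (by rw [hω]; norm_num)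
  obtain ⟨w, rfl⟩ : ∃ w, z = ω * w := ⟨z / ω, by field_simp⟩
  rw [norm_mul, hω, one_mul] at hz
  rw [← mul_add, norm_mul, hω, one_mul] at h
  have h1 : ‖w‖ ^ 2 = c ^ 2 := by rw [hz, sq_abs]
  have h2 : ‖(r : ℂ) + w‖ ^ 2 = (r + c) ^ 2 := by rw [h, sq_abs]
  rw [norm_sq_eq] at h1 h2
  simp only [add_re, ofReal_re, add_im, ofReal_im, zero_add] at h2
  have h3 : w.re = c := by
    have : r * (w.re - c) = 0 := by linear_combination (h2 - h1) / 2
    rcases mul_eq_zero.1 this with h | h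
    · exact absurd h hr
    · linarith
  have h4 : w.im = 0 := by
    rw [h3] at h1
    exact pow_eq_zero_iff two_ne_zero |>.1 (by linarith)
  congr 1
  exact Complex.ext h3 h4

/-- A motion from any initial position can be steered to any collinear chain with the prescribed
final distance. -/
theorem exists_joins_collinear (hl : ∀ j, 0 < l j) (s : Finset ι) (hs : s.Nonempty)
    {c : ι → ℝ} (hc : ∀ j, |c j| = l j) {α : ℝ → ℝ}
    (hα : Continuous α) (hr : ∀ t, α t ∈ ran l s) {a b : ℝ} (hab : a < b) {e : ι → ℂ}
    (he : IsConf l e) (hea : ‖∑ j ∈ s, e j‖ = α a) (hcb : |∑ j ∈ s, c j| = α b) :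
    ∃ (e' : ι → ℂ) (ω : ℂ), ‖ω‖ = 1 ∧ (∀ j ∈ s, e' j = ω * c j) ∧ Joins l s α a e b e' := by
  induction s using Finset.strongInduction generalizing α a e with
  | H s ih =>
    rcases hs.exists_eq_singleton_or_nontrivial with ⟨i, rfl⟩ | hnt
    · refine ⟨e, e i / c i, ?_, fun j hj => ?_, fun _ => e,
        ⟨continuous_const, fun _ => he, fun t => ?_⟩, rfl, rfl⟩
      · rw [norm_div, he i, Complex.norm_real, Real.norm_eq_abs, hc i, div_self (hl i).ne']
      · have : (c i : ℂ) ≠ 0 := by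
          have : c i ≠ 0 := abs_pos.1 (by rw [hc i]; exact hl i)
          exact_mod_cast this
        rw [Finset.mem_singleton.1 hj]
        field_simp
      · obtain ⟨e', he', h⟩ := hr t
        rw [← h]
        simp [he i, he' i]
    · have hcc : IsConf l fun j => (c j : ℂ) := fun j => by
        rw [Complex.norm_real, Real.norm_eq_abs, hc j]
      -- The detached edge is chosen for the target, so the initial position may have a closed
      -- subchain; `exists_joins_sum_ne_zero` repairs this.
      obtain ⟨i, hi, hne⟩ := exists_sum_erase_ne_zero hnt
        (fun j _ => norm_pos_iff.1 ((hcc j).symm ▸ hl j))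
      have hi' : i ∉ s.erase i := Finset.notMem_erase i s
      have hs' : (s.erase i).Nonempty := (Finset.erase_nonempty hi).2 hnt
      have hins := Finset.insert_erase hi
      have hss := Finset.erase_ssubset hi
      set s' := s.erase i
      rw [← hins] at hr hea hcb ⊢
      obtain ⟨a', ha', e₁, he₁, hea₁, hj₁, hne₁⟩ :=
        exists_joins_sum_ne_zero hl hi' hs' hα hr hab he hea
      set y₀ := ‖∑ j ∈ s', e₁ j‖ with hy₀
      set y₁ := ‖∑ j ∈ s', (c j : ℂ)‖ with hy₁
      have hy₀0 : 0 < y₀ := norm_pos_iff.2 hne₁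
      have hy₁0 : 0 < y₁ := norm_pos_iff.2 hne
      have hab' : 0 < b - a' := sub_pos.2 ha'.2
      -- Geometric interpolation from `y₀` to `y₁` stays positive.
      obtain ⟨y, hy, hy0, hyr, hy1, hy2, hyg⟩ := exists_admissible hl hi' hs' hα hr
        (g := fun t => Real.exp (Real.log y₀ + (t - a') / (b - a') * (Real.log y₁ - Real.log y₀)))
        (by fun_prop) (fun _ => Real.exp_pos _)
      have hcb' : ‖∑ j ∈ insert i s', (c j : ℂ)‖ = α b := by
        rw [← Complex.ofReal_sum, Complex.norm_real, Real.norm_eq_abs, hcb]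
      have t0 := he₁.triangle hi'
      have t1 := hcc.triangle hi'
      rw [hea₁] at t0
      rw [hcb'] at t1
      have hya : y a' = y₀ := by
        have := hyg a'
        simp only [sub_self, zero_div, zero_mul, add_zero, Real.exp_log hy₀0] at this
        exact this (he₁.mem_ran _) t0.1 t0.2
      have hyb : y b = y₁ := by
        have := hyg b
        simp only [div_self hab'.ne', one_mul, add_sub_cancel, Real.exp_log hy₁0] at this
        exact this (hcc.mem_ran _) t1.1 t1.2
      obtain ⟨e', ω, hω, he', f, hf, hfa, hfb⟩ := ih s' hss hs' hy hyr ha'.2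
        he₁ (hy₀.symm.trans hya.symm)
        (by rw [hyb, hy₁, ← Complex.ofReal_sum, Complex.norm_real, Real.norm_eq_abs])
      obtain ⟨F, hF, hFa, hFj⟩ := hf.exists_insert hl hi' hα hy0 hy1 hy2 (a := a')
        (by rw [hfa, hea₁])
      have hFs : ∀ j ∈ s', F b j = ω * c j := fun j hj => by
        rw [hFj b j (fun h => hi' (h ▸ hj)), hfb, he' j hj]
      refine ⟨F b, ω, hω, fun j hj => ?_, hj₁.trans ⟨F, hF, hFa.trans hfa, rfl⟩ ha'.1 ha'.2.le⟩
      rcases Finset.mem_insert.1 hj with rfl | hj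
      -- Once the subchain has reached its collinear target, the edge `i` is forced.
      · refine eq_of_norm_add_eq (r := ∑ j ∈ s', c j) hω ?_ ?_ ?_
        · intro h
          apply hne
          rw [← Complex.ofReal_sum, h, Complex.ofReal_zero]
        · rw [hF.conf b, hc]
        · have h1 := hF.dist_eq b
          rw [Finset.sum_insert hi', Finset.sum_congr rfl hFs, ← Finset.mul_sum,
            ← Complex.ofReal_sum, ← hcb, Finset.sum_insert hi'] at h1
          rw [add_comm (ω * _), h1, add_comm]
      · exact hFs j hj

end Joins

/-! ### Motions near a chain that is not collinear -/

/-- At `v₀ = 0` the argument is interpolated, and small norm alone keeps the path in `W`. Elsewhere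
the segment from `v₁` to `v₂` is rescaled radially to norm `α t`. -/
lemma exists_path_of_norm (v₀ : ℂ) {W : Set ℂ} (hW : W ∈ 𝓝 v₀) :
    ∃ W' ∈ 𝓝 v₀, ∃ δ > 0, ∀ α : ℝ → ℝ, Continuous α → (∀ t, 0 ≤ α t) → ∀ a b : ℝ, a < b →
      (∀ t ∈ Set.Icc a b, |α t - ‖v₀‖| < δ) → ∀ v₁ ∈ W', ∀ v₂ ∈ W', ‖v₁‖ = α a → ‖v₂‖ = α b →
      ∃ v : ℝ → ℂ, ContinuousOn v (Set.Icc a b) ∧ v a = v₁ ∧ v b = v₂ ∧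
        (∀ t ∈ Set.Icc a b, ‖v t‖ = α t) ∧ ∀ t ∈ Set.Icc a b, v t ∈ W := by
  by_cases h0 : v₀ = 0
  · subst h0
    obtain ⟨δ, hδ, hball⟩ := Metric.mem_nhds_iff.1 hW
    refine ⟨Set.univ, univ_mem, δ, hδ, fun α hα hα0 a b hab hδt v₁ _ v₂ _ h₁ h₂ => ?_⟩
    have hab' : b - a ≠ 0 := (sub_pos.2 hab).ne'
    set φ : ℝ → ℝ := fun t => arg v₁ + (t - a) / (b - a) * (arg v₂ - arg v₁) with hφ
    have hn : ∀ t, ‖(α t : ℂ) * Complex.exp (φ t * I)‖ = α t := fun t => by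
      rw [norm_mul, Complex.norm_exp_ofReal_mul_I, mul_one, Complex.norm_real,
        Real.norm_of_nonneg (hα0 t)]
    refine ⟨fun t => α t * Complex.exp (φ t * I), Continuous.continuousOn (by fun_prop), ?_, ?_,
      fun t _ => hn t, fun t ht => hball ?_⟩
    · simp only [hφ, sub_self, zero_div, zero_mul, add_zero, ← h₁, norm_mul_exp_arg_mul_I]
    · simp only [hφ, div_self hab', one_mul, add_sub_cancel, ← h₂, norm_mul_exp_arg_mul_I]
    · have := hδt t ht
      rw [norm_zero, sub_zero, abs_of_nonneg (hα0 t)] at this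
      rw [mem_ball_zero_iff, hn]
      exact this
  · have hn0 : (‖v₀‖ : ℂ) ≠ 0 := by exact_mod_cast norm_ne_zero_iff.2 h0
    have hc : ContinuousAt (fun p : ℝ × ℂ => (p.1 : ℂ) * (p.2 / ‖p.2‖)) (‖v₀‖, v₀) := by
      refine ContinuousAt.mul (by fun_prop) (ContinuousAt.div (by fun_prop) (by fun_prop) hn0)
    have hev : ∀ᶠ p : ℝ × ℂ in 𝓝 (‖v₀‖, v₀), (p.1 : ℂ) * (p.2 / ‖p.2‖) ∈ W ∧ p.2 ≠ 0 := by
      refine (hc.eventually_mem ?_).and (continuousAt_snd.eventually_ne h0)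
      simpa [mul_div_cancel₀ _ hn0] using hW
    obtain ⟨r, hr, hball⟩ := Metric.eventually_nhds_iff_ball.1 hev
    refine ⟨Metric.ball v₀ r, Metric.ball_mem_nhds _ hr, r, hr,
      fun α hα hα0 a b hab hδt v₁ hv₁ v₂ hv₂ h₁ h₂ => ?_⟩
    have hab' : 0 < b - a := sub_pos.2 hab
    set z : ℝ → ℂ := fun t => AffineMap.lineMap v₁ v₂ ((t - a) / (b - a)) with hz
    have hzc : Continuous z := AffineMap.lineMap_continuous.comp (by fun_prop)
    have hzr : ∀ t ∈ Set.Icc a b, z t ∈ Metric.ball v₀ r := fun t ht =>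
      (convex_ball v₀ r).lineMap_mem hv₁ hv₂
        ⟨div_nonneg (by linarith [ht.1]) hab'.le, (div_le_one hab').2 (by linarith [ht.2])⟩
    have hg : ∀ t ∈ Set.Icc a b, (α t : ℂ) * (z t / ‖z t‖) ∈ W ∧ z t ≠ 0 := fun t ht =>
      hball (α t, z t) (by
        rw [Metric.mem_ball, Prod.dist_eq]
        exact max_lt (hδt t ht) (hzr t ht))
    have ha : a ∈ Set.Icc a b := ⟨le_rfl, hab.le⟩
    have hb : b ∈ Set.Icc a b := ⟨hab.le, le_rfl⟩
    have hza : z a = v₁ := by simp [hz]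
    have hzb : z b = v₂ := by simp [hz, hab'.ne']
    refine ⟨fun t => α t * (z t / ‖z t‖), ?_, ?_, ?_, fun t ht => ?_, fun t ht => (hg t ht).1⟩
    · refine ContinuousOn.mul (by fun_prop) (ContinuousOn.div (by fun_prop) (by fun_prop) ?_)
      intro t ht
      exact_mod_cast norm_ne_zero_iff.2 (hg t ht).2
    · have := (hg a ha).2
      rw [hza] at this
      have : (‖v₁‖ : ℂ) ≠ 0 := by exact_mod_cast norm_ne_zero_iff.2 this
      simp only [hza, ← h₁]
      field_simp
    · have := (hg b hb).2
      rw [hzb] at this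
      have : (‖v₂‖ : ℂ) ≠ 0 := by exact_mod_cast norm_ne_zero_iff.2 this
      simp only [hzb, ← h₂]
      field_simp
    · rw [norm_mul, norm_div, Complex.norm_real, Complex.norm_real, norm_norm,
        div_self (norm_ne_zero_iff.2 (hg t ht).2), mul_one, Real.norm_of_nonneg (hα0 t)]

section Local

variable {ι : Type*} {l : ι → ℝ}

lemma IsConf.smul {e : ι → ℂ} (he : IsConf l e) {ω : ℂ} (hω : ‖ω‖ = 1) : IsConf l (ω • e) :=
  fun j => by simp [hω, he j]

variable [Fintype ι]

lemma norm_sum_smul (e : ι → ℂ) {ω : ℂ} (hω : ‖ω‖ = 1) : ‖∑ k, (ω • e) k‖ = ‖∑ k, e k‖ := by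
  simp only [Pi.smul_apply]
  rw [← Finset.smul_sum, norm_smul, hω, one_mul]

/-- Any two positions close to `e` and to `e'` are joined, up to a rotation, by motions over all
paths of distances close to `x`. -/
def Linked (l : ι → ℝ) (x : ℝ) (e e' : ι → ℂ) : Prop :=
  ∃ U ∈ 𝓝 e, ∃ U' ∈ 𝓝 e', ∃ δ > 0, ∀ α : ℝ → ℝ, Continuous α →
    (∀ t, α t ∈ ran l Finset.univ) → ∀ a b : ℝ, a < b → (∀ t ∈ Set.Icc a b, |α t - x| < δ) →
    ∀ e₁ ∈ U, ∀ e₂ ∈ U', IsConf l e₁ → IsConf l e₂ → ‖∑ k, e₁ k‖ = α a → ‖∑ k, e₂ k‖ = α b →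
    ∃ ω : ℂ, ‖ω‖ = 1 ∧ Joins l Finset.univ α a e₁ b (ω • e₂)

lemma Linked.symm {x : ℝ} {e e' : ι → ℂ} (h : Linked l x e e') : Linked l x e' e := by
  obtain ⟨U, hU, U', hU', δ, hδ, h⟩ := h
  refine ⟨U', hU', U, hU, δ, hδ, fun α hα hr a b hab hδt e₁ h₁ e₂ h₂ hc₁ hc₂ hs₁ hs₂ => ?_⟩
  obtain ⟨ω, hω, hj⟩ := h (fun t => α (-t)) (hα.comp continuous_neg) (fun t => hr _) (-b) (-a)
    (by linarith) (fun t ht => hδt (-t) ⟨by linarith [ht.2], by linarith [ht.1]⟩)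
    e₂ h₂ e₁ h₁ hc₂ hc₁ (by simpa using hs₂) (by simpa using hs₁)
  have hω0 : ω ≠ 0 := norm_pos_iff.1 (by rw [hω]; norm_num)
  have hω' : ‖ω⁻¹‖ = 1 := by rw [norm_inv, hω, inv_one]
  refine ⟨ω⁻¹, hω', ?_⟩
  have := (hj.symm).rotate hω'
  simpa [smul_smul, inv_mul_cancel₀ hω0] using this

lemma Linked.smul_right {x : ℝ} {e e' : ι → ℂ} (h : Linked l x e e') {ω : ℂ} (hω : ‖ω‖ = 1) :
    Linked l x e (ω • e') := by
  obtain ⟨U, hU, U', hU', δ, hδ, h⟩ := h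
  have hω0 : ω ≠ 0 := norm_pos_iff.1 (by rw [hω]; norm_num)
  have hω' : ‖ω⁻¹‖ = 1 := by rw [norm_inv, hω, inv_one]
  refine ⟨U, hU, Set.preimage (fun e : ι → ℂ => ω⁻¹ • e) U', ?_, δ, hδ,
    fun α hα hr a b hab hδt e₁ h₁ e₂ h₂ hc₁ hc₂ hs₁ hs₂ => ?_⟩
  · refine (continuous_const_smul ω⁻¹).continuousAt.preimage_mem_nhds ?_
    rwa [smul_smul, inv_mul_cancel₀ hω0, one_smul]
  · obtain ⟨ω', hω₁, hj⟩ := h α hα hr a b hab hδt e₁ h₁ _ h₂ hc₁ (hc₂.smul hω') hs₁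
      (by rw [norm_sum_smul _ hω', hs₂])
    exact ⟨ω' * ω⁻¹, by rw [norm_mul, hω', hω₁, one_mul], by rwa [mul_smul]⟩

/-- A motion over `α` from `p` can be continued to a position congruent to `q`, provided that
positions reached from `p` and from `q` over the same value of `α` are linked. -/
theorem exists_joins_of_linked {α : ℝ → ℝ}
    (hα : Continuous α) {f g : ℝ → ι → ℂ} (hf : IsLift l Finset.univ α f)
    (hg : IsLift l Finset.univ α g) {a b c : ℝ} (hab : a < b) (hc : c ∈ Set.Icc a b)
    (h : Linked l (α c) (f c) (g c)) :
    ∃ ω : ℂ, ‖ω‖ = 1 ∧ Joins l Finset.univ α a (f a) b (ω • g b) := by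
  obtain ⟨U, hU, U', hU', δ, hδ, h⟩ := h
  have hr : ∀ t, α t ∈ ran l Finset.univ := fun t => by
    rw [← hf.dist_eq t]; exact (hf.conf t).mem_ran _
  have hev : ∀ᶠ t in 𝓝 c, f t ∈ U ∧ g t ∈ U' ∧ |α t - α c| < δ :=
    (hf.cont.continuousAt.eventually_mem hU).and ((hg.cont.continuousAt.eventually_mem hU').and
      (hα.continuousAt.eventually_mem (Metric.ball_mem_nhds _ hδ)))
  obtain ⟨ε, hε, hball⟩ := Metric.eventually_nhds_iff_ball.1 hev
  rw [Real.ball_eq_Ioo] at hball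
  -- The window around `c` is clipped to `[a, b]`, since `c` may be an end point; it still has
  -- positive length.
  have hlt : max a (c - ε / 2) < min b (c + ε / 2) :=
    max_lt (lt_min hab (by linarith [hc.1])) (lt_min (by linarith [hc.2]) (by linarith))
  set a' := max a (c - ε / 2)
  set b' := min b (c + ε / 2)
  have ha' : c - ε / 2 ≤ a' := le_max_right _ _
  have hb' : b' ≤ c + ε / 2 := min_le_right _ _
  have hin : ∀ t ∈ Set.Icc a' b', f t ∈ U ∧ g t ∈ U' ∧ |α t - α c| < δ := fun t ht =>
    hball t ⟨by linarith [ht.1], by linarith [ht.2]⟩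
  obtain ⟨ω, hω, hj⟩ := h α hα hr a' b' hlt (fun t ht => (hin t ht).2.2)
    (f a') (hin a' ⟨le_rfl, hlt.le⟩).1 (g b') (hin b' ⟨hlt.le, le_rfl⟩).2.1 (hf.conf _) (hg.conf _)
    (hf.dist_eq _) (hg.dist_eq _)
  have haa : a ≤ a' := le_max_left _ _
  have hbb : b' ≤ b := min_le_left _ _
  exact ⟨ω, hω, ((hf.joins a a').trans hj haa hlt.le).trans ((hg.joins b' b).rotate hω)
    (haa.trans hlt.le) hbb⟩

variable [DecidableEq ι]

/-- All edges but `i` and `j` are interpolated linearly and rescaled to their lengths; `i` and `j`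
then close up with the prescribed sum. Near `e₀` their triangle is nondegenerate with constant
orientation, so the motion meets both given positions. -/
lemma exists_motion_of_sum (hl : ∀ j, 0 < l j) {e₀ : ι → ℂ} (he₀ : IsConf l e₀) {i j : ι}
    (hij : (e₀ i * (starRingEnd ℂ) (e₀ j)).im ≠ 0) :
    ∃ U ∈ 𝓝 e₀, ∃ W ∈ 𝓝 (∑ k, e₀ k), ∀ a b : ℝ, a < b → ∀ v : ℝ → ℂ,
      ContinuousOn v (Set.Icc a b) → (∀ t ∈ Set.Icc a b, v t ∈ W) →
      ∀ e₁ ∈ U, ∀ e₂ ∈ U, IsConf l e₁ → IsConf l e₂ → ∑ k, e₁ k = v a → ∑ k, e₂ k = v b →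
      ∃ f : ℝ → ι → ℂ, ContinuousOn f (Set.Icc a b) ∧ (∀ t ∈ Set.Icc a b, IsConf l (f t)) ∧
        (∀ t ∈ Set.Icc a b, ∑ k, f t k = v t) ∧ f a = e₁ ∧ f b = e₂ := by
  have hne : j ≠ i := by
    rintro rfl
    apply hij
    rw [Complex.mul_conj, Complex.ofReal_im]
  obtain ⟨σ, hσ, hs⟩ : ∃ σ : ℝ, σ ^ 2 = 1 ∧ 0 < σ * -(e₀ i * (starRingEnd ℂ) (e₀ j)).im := by
    rcases lt_or_gt_of_ne hij with h | h
    · exact ⟨1, by norm_num, by linarith⟩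
    · exact ⟨-1, by norm_num, by linarith⟩
  -- `triEdge` is used with `w = -(e i + e j)`, for which adding `e i` leaves `-e j`, of norm `l j`.
  have him : ∀ e : ι → ℂ, (e i * (starRingEnd ℂ) (-(e i + e j))).im =
      -(e i * (starRingEnd ℂ) (e j)).im := fun e => by
    simp only [map_neg, map_add, mul_im, neg_im, neg_re, add_im, add_re, conj_re, conj_im]
    ring
  have hw : ∀ e : ι → ℂ, 0 < σ * -(e i * (starRingEnd ℂ) (e j)).im → e i + e j ≠ 0 := by
    intro e h h'
    rw [← him, h'] at h
    simp at h
  have hadd : ∀ e : ι → ℂ, -(e i + e j) + e i = -e j := fun e => by ring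
  set R : Finset ι := (Finset.univ.erase i).erase j with hR
  have hsum : ∀ e : ι → ℂ, ∑ k, e k = e i + e j + ∑ k ∈ R, e k := fun e => by
    rw [← Finset.add_sum_erase _ _ (Finset.mem_univ i),
      ← Finset.add_sum_erase _ _ (Finset.mem_erase.2 ⟨hne, Finset.mem_univ j⟩), add_assoc]
  have hfix : ∀ e : ι → ℂ, IsConf l e → 0 < σ * -(e i * (starRingEnd ℂ) (e j)).im →
      triEdge σ (-(e i + e j)) (l i) (l j) = e i := by
    intro e he h
    have := eq_triEdge (e := e i) hσ (neg_ne_zero.2 (hw e h)) (by rw [him]; exact h.le)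
    rw [hadd, norm_neg, he i, he j] at this
    exact this.symm
  set ρ : (ι → ℂ) → ι → ℂ := fun z k => l k * (z k / ‖z k‖) with hρ
  have hρe : ∀ e, IsConf l e → ρ e = e := by
    intro e he
    funext k
    have : (l k : ℂ) ≠ 0 := by exact_mod_cast (hl k).ne'
    simp only [hρ, he k]
    field_simp
  have he₀0 : ∀ k, e₀ k ≠ 0 := fun k => norm_pos_iff.1 (by rw [he₀ k]; exact hl k)
  have hρc : ∀ z : ι → ℂ, (∀ k, z k ≠ 0) → ContinuousAt ρ z := by
    intro z hz
    refine continuousAt_pi.2 fun k => ?_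
    have hk : ContinuousAt (fun z : ι → ℂ => z k) z := (continuous_apply k).continuousAt
    have hk' : (‖z k‖ : ℂ) ≠ 0 := by exact_mod_cast norm_ne_zero_iff.2 (hz k)
    exact continuousAt_const.mul (hk.div (continuous_ofReal.continuousAt.comp hk.norm) hk')
  have hev : ∀ᶠ p : ℂ × (ι → ℂ) in 𝓝 (∑ k, e₀ k) ×ˢ 𝓝 e₀,
      (p.1 - ∑ k ∈ R, ρ p.2 k ≠ 0 ∧ 0 < heron ‖p.1 - ∑ k ∈ R, ρ p.2 k‖ (l i) (l j)) ∧
        ∀ k, p.2 k ≠ 0 := by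
    rw [← nhds_prod_eq]
    have hρ2 : ContinuousAt (fun p : ℂ × (ι → ℂ) => ρ p.2) (∑ k, e₀ k, e₀) :=
      Tendsto.comp (y := 𝓝 e₀) (hρc e₀ he₀0) continuousAt_snd
    have hwc : ContinuousAt (fun p : ℂ × (ι → ℂ) => p.1 - ∑ k ∈ R, ρ p.2 k) (∑ k, e₀ k, e₀) := by
      refine continuousAt_fst.sub (tendsto_finsetSum _ fun k _ => ?_)
      exact (continuous_apply k).continuousAt.comp hρ2
    have hw0 : ∑ k, e₀ k - ∑ k ∈ R, ρ e₀ k = e₀ i + e₀ j := by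
      rw [hρe e₀ he₀, hsum]; ring
    have hhc : ContinuousAt (fun p : ℂ × (ι → ℂ) => heron ‖p.1 - ∑ k ∈ R, ρ p.2 k‖ (l i) (l j))
        (∑ k, e₀ k, e₀) := by
      unfold heron
      exact ((((hwc.norm.pow 2).const_mul 4).mul_const _)).sub
        (((continuousAt_const.sub (hwc.norm.pow 2)).sub continuousAt_const).pow 2)
    refine ((hwc.eventually_ne ?_).and (hhc.eventually_const_lt ?_)).and ?_
    · simp only [hw0]
      exact hw e₀ hs
    · simp only [hw0]
      have := heron_norm (-(e₀ i + e₀ j)) (e₀ i)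
      rw [hadd, norm_neg, norm_neg, he₀ i, he₀ j, him] at this
      rw [this]
      have : (e₀ i * (starRingEnd ℂ) (e₀ j)).im ^ 2 > 0 := by positivity
      linarith
    · refine eventually_all.2 fun k => ?_
      have : ContinuousAt (fun p : ℂ × (ι → ℂ) => p.2 k) (∑ k, e₀ k, e₀) := by fun_prop
      exact this.eventually_ne (he₀0 k)
  obtain ⟨pW, hpW, pN, hpN, hWN⟩ := eventually_prod_iff.1 hev
  obtain ⟨r, hr, hball⟩ := Metric.eventually_nhds_iff_ball.1 hpN
  have hsgn : ∀ᶠ e : ι → ℂ in 𝓝 e₀, 0 < σ * -(e i * (starRingEnd ℂ) (e j)).im := by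
    have : Continuous fun e : ι → ℂ => σ * -(e i * (starRingEnd ℂ) (e j)).im := by fun_prop
    exact this.continuousAt.eventually_const_lt hs
  refine ⟨{e | e ∈ Metric.ball e₀ r ∧ 0 < σ * -(e i * (starRingEnd ℂ) (e j)).im},
    (eventually_mem_set.2 (Metric.ball_mem_nhds e₀ hr)).and hsgn, {v | pW v}, hpW,
    fun a b hab v hv hvW e₁ h₁ e₂ h₂ hc₁ hc₂ hs₁ hs₂ => ?_⟩
  have hab' : 0 < b - a := sub_pos.2 hab
  set z : ℝ → ι → ℂ := fun t => AffineMap.lineMap e₁ e₂ ((t - a) / (b - a)) with hz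
  have hzc : Continuous z := AffineMap.lineMap_continuous.comp (by fun_prop)
  have hzr : ∀ t ∈ Set.Icc a b, z t ∈ Metric.ball e₀ r := fun t ht =>
    (convex_ball e₀ r).lineMap_mem h₁.1 h₂.1
      ⟨div_nonneg (by linarith [ht.1]) hab'.le, (div_le_one hab').2 (by linarith [ht.2])⟩
  have hza : z a = e₁ := by simp [hz]
  have hzb : z b = e₂ := by simp [hz, hab'.ne']
  set w : ℝ → ℂ := fun t => v t - ∑ k ∈ R, ρ (z t) k with hwdef
  have hgood : ∀ t ∈ Set.Icc a b, (w t ≠ 0 ∧ 0 < heron ‖w t‖ (l i) (l j)) ∧ ∀ k, z t k ≠ 0 :=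
    fun t ht => hWN (hvW t ht) (hball _ (hzr t ht))
  have hρz : ContinuousOn (fun t => ρ (z t)) (Set.Icc a b) := fun t ht =>
    (ContinuousAt.comp (hρc _ (hgood t ht).2) hzc.continuousAt).continuousWithinAt
  have hρzk : ∀ k, ContinuousOn (fun t => ρ (z t) k) (Set.Icc a b) := fun k =>
    (continuous_apply k).comp_continuousOn hρz
  have hwc : ContinuousOn w (Set.Icc a b) :=
    hv.sub (continuousOn_finsetSum _ fun k _ => hρzk k)
  have hE : ContinuousOn (fun t => triEdge σ (-w t) (l i) (l j)) (Set.Icc a b) :=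
    continuousOn_iff_continuous_domRestrict.2 (continuous_triEdge σ (l i)
      (w := fun t : Set.Icc a b => -w t) (x := fun _ => l j)
      (continuousOn_iff_continuous_domRestrict.1 hwc.neg) continuous_const
      fun t => neg_ne_zero.2 (hgood t t.2).1.1)
  set f : ℝ → ι → ℂ := fun t k => if k = i then triEdge σ (-w t) (l i) (l j) else
    if k = j then w t - triEdge σ (-w t) (l i) (l j) else ρ (z t) k with hf
  have hend : ∀ t, ∀ e : ι → ℂ, z t = e → IsConf l e → ∑ k, e k = v t →
      0 < σ * -(e i * (starRingEnd ℂ) (e j)).im → f t = e := by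
    intro t e hze he hes hse
    have hwt : w t = e i + e j := by
      simp only [hwdef]
      rw [hze, hρe e he, ← hes, hsum]; ring
    funext k
    simp only [hf, hze, hρe e he, hwt, hfix e he hse]
    split_ifs with h1 h2
    · rw [h1]
    · rw [h2]; ring
    · rfl
  refine ⟨f, continuousOn_pi.2 fun k => ?_, fun t ht k => ?_, fun t ht => ?_,
    hend a e₁ hza hc₁ hs₁ h₁.2, hend b e₂ hzb hc₂ hs₂ h₂.2⟩
  · simp only [hf]
    split_ifs
    exacts [hE, hwc.sub hE, hρzk k]
  · have hg := hgood t ht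
    have hB : 0 ≤ heron ‖-w t‖ (l i) (l j) := by rw [norm_neg]; exact hg.1.2.le
    simp only [hf]
    split_ifs with h1 h2
    · rw [h1]
      exact norm_triEdge hσ (neg_ne_zero.2 hg.1.1) (hl i).le hB
    · rw [h2, ← norm_neg, neg_sub, sub_eq_neg_add]
      exact norm_add_triEdge hσ (neg_ne_zero.2 hg.1.1) (hl i).le (hl j).le hB
    · simp only [hρ]
      rw [norm_mul, norm_div, Complex.norm_real, Complex.norm_real, norm_norm,
        div_self (norm_ne_zero_iff.2 (hg.2 k)), mul_one, Real.norm_of_nonneg (hl k).le]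
  · have hrest : ∑ k ∈ R, f t k = ∑ k ∈ R, ρ (z t) k := Finset.sum_congr rfl fun k hk => by
      have h1 := Finset.ne_of_mem_erase hk
      have h2 := Finset.ne_of_mem_erase (Finset.mem_of_mem_erase hk)
      simp [hf, h1, h2]
    rw [hsum, hrest]
    simp only [hf, if_true, hne, if_false, hwdef]
    ring

/-- The path of distances is lifted first to a path of end-to-end vectors, then to a motion of the
chain. -/
lemma eventually_linked [Nonempty ι] (hl : ∀ j, 0 < l j) {e : ι → ℂ} (he : IsConf l e) {i j : ι}
    (hij : (e i * (starRingEnd ℂ) (e j)).im ≠ 0) : ∀ᶠ e' in 𝓝 e, Linked l ‖∑ k, e k‖ e e' := by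
  obtain ⟨U, hU, W, hW, h⟩ := exists_motion_of_sum hl he hij
  obtain ⟨W', hW', δ, hδ, h'⟩ := exists_path_of_norm _ hW
  have hc : Continuous fun e : ι → ℂ => ∑ k, e k := by fun_prop
  have hU' : U ∩ Set.preimage (fun e : ι → ℂ => ∑ k, e k) W' ∈ 𝓝 e :=
    inter_mem hU (hc.continuousAt.preimage_mem_nhds hW')
  filter_upwards [eventually_mem_nhds_iff.2 hU'] with e' he'
  refine ⟨_, hU', _, he', δ, hδ, fun α hα hr a b hab hδt e₁ h₁ e₂ h₂ hc₁ hc₂ hs₁ hs₂ => ?_⟩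
  have hα0 : ∀ t, 0 ≤ α t := fun t => by
    obtain ⟨e, -, het⟩ := hr t
    rw [← het]; exact norm_nonneg _
  obtain ⟨v, hv, hva, hvb, hvn, hvW⟩ := h' α hα hα0 a b hab hδt _ h₁.2 _ h₂.2 hs₁ hs₂
  obtain ⟨f, hf, hfc, hfs, hfa, hfb⟩ := h a b hab v hv hvW e₁ h₁.1 e₂ h₂.1 hc₁ hc₂ hva.symm hvb.symm
  refine ⟨1, norm_one, ?_⟩
  rw [one_smul, ← hfa, ← hfb]
  exact joins_of_Icc hl Finset.univ_nonempty hα hr hab.le hf hfc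
    (fun t ht => by rw [hfs t ht, hvn t ht])

/-- The distance is an open map onto its range, even at collinear positions: the identity path of
distances, clamped to the range, lifts through `e`. -/
lemma exists_near_of_mem_ran [Nonempty ι] (hl : ∀ j, 0 < l j) {e : ι → ℂ} (he : IsConf l e)
    {U : Set (ι → ℂ)} (hU : U ∈ 𝓝 e) :
    ∃ δ > 0, ∀ x ∈ ran l Finset.univ, |x - ‖∑ k, e k‖| < δ →
      ∃ e' ∈ U, IsConf l e' ∧ ‖∑ k, e' k‖ = x := by
  obtain ⟨m, M, hmM⟩ := exists_ran_eq_Icc hl Finset.univ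
  have hx₀ := he.mem_ran Finset.univ
  rw [hmM] at hx₀
  have hle : m ≤ M := hx₀.1.trans hx₀.2
  obtain ⟨f, hf, hfe⟩ := exists_isLift hl Finset.univ Finset.univ_nonempty
    (α := fun t => (Set.projIcc m M hle t : ℝ)) (by fun_prop)
    (fun t => by rw [hmM]; exact (Set.projIcc m M hle t).2) ‖∑ k, e k‖ he
    (by rw [Set.projIcc_of_mem hle hx₀])
  have := hf.cont.continuousAt.preimage_mem_nhds (by rw [hfe]; exact hU)
  obtain ⟨δ, hδ, hball⟩ := Metric.mem_nhds_iff.1 this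
  refine ⟨δ, hδ, fun x hx hxδ => ⟨f x, hball hxδ, hf.conf x, ?_⟩⟩
  rw [hmM] at hx
  rw [hf.dist_eq, Set.projIcc_of_mem hle hx]

/-- At the middle time a position near `e₂` with exactly the required distance is needed;
`exists_near_of_mem_ran` supplies it. -/
lemma Linked.trans [Nonempty ι] (hl : ∀ j, 0 < l j) {e₁ e₂ e₃ : ι → ℂ} (he₂ : IsConf l e₂)
    (h₁ : Linked l ‖∑ k, e₂ k‖ e₁ e₂) (h₂ : Linked l ‖∑ k, e₂ k‖ e₂ e₃) :
    Linked l ‖∑ k, e₂ k‖ e₁ e₃ := by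
  obtain ⟨U, hU, U', hU', δ, hδ, h⟩ := h₁
  obtain ⟨V, hV, V', hV', ε, hε, h'⟩ := h₂
  obtain ⟨η, hη, hnear⟩ := exists_near_of_mem_ran hl he₂ (inter_mem hU' hV)
  refine ⟨U, hU, V', hV', min δ (min ε η), lt_min hδ (lt_min hε hη),
    fun α hα hr a b hab hδt e h₁ e' h₂ hc hc' hs hs' => ?_⟩
  simp only [lt_min_iff] at hδt
  have h1 : a < (a + b) / 2 := by linarith
  have h2 : (a + b) / 2 < b := by linarith
  obtain ⟨d, hd, hdc, hds⟩ := hnear _ (hr ((a + b) / 2)) (hδt _ ⟨h1.le, h2.le⟩).2.2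
  obtain ⟨ω, hω, hj⟩ := h α hα hr a _ h1 (fun t ht => (hδt t ⟨ht.1, ht.2.trans h2.le⟩).1) e h₁ d
    hd.1 hc hdc hs hds
  obtain ⟨ω', hω', hj'⟩ := h' α hα hr _ b h2 (fun t ht => (hδt t ⟨h1.le.trans ht.1, ht.2⟩).2.1) d
    hd.2 e' h₂ hdc hc' hds hs'
  refine ⟨ω * ω', by rw [norm_mul, hω, hω', one_mul], ?_⟩
  rw [mul_smul]
  exact hj.trans (hj'.rotate hω) h1.le h2.le

end Local

/-! ### Path linkages and their edge vectors -/

section Path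

variable {V E : Type*} {P : Linkage V E} {k : ℕ}

/-- The edge vectors of a configuration of a path whose vertices are enumerated by `φ`. -/
def edge (φ : Fin (k + 1) ≃ V) (p : V → ℂ) (i : Fin k) : ℂ := p (φ i.succ) - p (φ i.castSucc)

lemma sum_succ_sub_castSucc {k : ℕ} (g : Fin (k + 1) → ℂ) :
    ∑ i : Fin k, (g i.succ - g i.castSucc) = g (Fin.last k) - g 0 := by
  induction k with
  | zero => simp
  | succ k ih =>
    rw [Fin.sum_univ_castSucc]
    have := ih fun i => g i.castSucc
    simp only [Fin.succ_castSucc, Fin.castSucc_zero] at this ⊢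
    rw [this, Fin.succ_last]
    ring

/-- The positions of the vertices of a path with given edge vectors, starting at the origin. -/
def ofEdges (φ : Fin (k + 1) ≃ V) (e : Fin k → ℂ) (v : V) : ℂ :=
  ∑ i : Fin k, if i.val < (φ.symm v).val then e i else 0

lemma edge_ofEdges (φ : Fin (k + 1) ≃ V) (e : Fin k → ℂ) : edge φ (ofEdges φ e) = e := by
  funext i
  simp only [edge, ofEdges, Equiv.symm_apply_apply]
  rw [← Finset.sum_sub_distrib, Finset.sum_eq_single i]
  · simp
  · intro j _ hj
    have : j.val ≠ i.val := fun h => hj (Fin.ext h)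
    rcases lt_or_gt_of_ne this with h | h
    · simp [h, Nat.lt_succ_of_lt h]
    · simp [h.not_gt, show ¬ j.val < i.val + 1 by omega]
  · simp

lemma edge_injective (φ : Fin (k + 1) ≃ V) {p q : V → ℂ} (h : edge φ p = edge φ q)
    (h0 : p (φ 0) = q (φ 0)) : p = q := by
  have : ∀ m : Fin (k + 1), p (φ m) = q (φ m) := by
    intro m
    induction m using Fin.induction with
    | zero => exact h0
    | succ i ih =>
      have := congrFun h i
      simp only [edge, ih] at this
      exact sub_left_injective this
  funext v
  simpa using this (φ.symm v)

/-- A linear isometry of the plane is a rotation, possibly after conjugation; the determinant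
excludes conjugation. -/
lemma exists_circle_of_mem_planeMotions {g : ℂ ≃ᵃⁱ[ℝ] ℂ} (hg : g ∈ planeMotions) :
    ∃ ω : ℂ, ‖ω‖ = 1 ∧ ∀ x y, g x - g y = ω * (x - y) := by
  have hsub : ∀ x y, g x - g y = g.linearIsometryEquiv (x - y) := fun x y => by
    rw [← vsub_eq_sub, ← vsub_eq_sub, AffineIsometryEquiv.map_vsub]
  obtain ⟨a, ha | ha⟩ := linear_isometry_complex g.linearIsometryEquiv
  · refine ⟨a, Circle.norm_coe a, fun x y => ?_⟩
    rw [hsub, ha, rotation_apply]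
  · have h : 0 < LinearMap.det (g.linearIsometryEquiv.toLinearEquiv : ℂ →ₗ[ℝ] ℂ) := hg
    have e : ((conjLIE.trans (rotation a)).toLinearEquiv : ℂ →ₗ[ℝ] ℂ) =
      ((rotation a).toLinearEquiv : ℂ →ₗ[ℝ] ℂ) ∘ₗ (conjLIE.toLinearEquiv : ℂ →ₗ[ℝ] ℂ) := rfl
    rw [ha, e, LinearMap.det_comp, det_rotation, det_conjLIE] at h
    norm_num at h

lemma exists_planeMotion {ω : ℂ} (hω : ‖ω‖ = 1) (x y : ℂ) :
    ∃ g : planeMotions, g.1 x = y ∧ ∀ z w, g.1 z - g.1 w = ω * (z - w) := by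
  set a : Circle := ⟨ω, mem_sphere_zero_iff_norm.2 hω⟩
  set g : ℂ ≃ᵃⁱ[ℝ] ℂ := (rotation a).toAffineIsometryEquiv.trans
    (AffineIsometryEquiv.constVAdd ℝ ℂ (y - ω * x)) with hg
  have hga : ∀ z, g z = y - ω * x + ω * z := fun z => rfl
  refine ⟨⟨g, ?_⟩, ?_, fun z w => ?_⟩
  · have : (g.linearIsometryEquiv.toLinearEquiv : ℂ →ₗ[ℝ] ℂ) =
        ((rotation a).toLinearEquiv : ℂ →ₗ[ℝ] ℂ) := rfl
    change 0 < LinearMap.det (g.linearIsometryEquiv.toLinearEquiv : ℂ →ₗ[ℝ] ℂ)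
    rw [this, det_rotation]
    exact one_pos
  · change g x = y
    rw [hga]; ring
  · change g z - g w = _
    rw [hga, hga]; ring

lemma toModuli_eq_iff (φ : Fin (k + 1) ≃ V) (p q : P.Config) :
    toModuli p = toModuli q ↔ ∃ ω : ℂ, ‖ω‖ = 1 ∧ edge φ p.1 = ω • edge φ q.1 := by
  refine (Quotient.eq (r := MulAction.orbitRel planeMotions P.Config)).trans ?_
  rw [MulAction.orbitRel_apply]
  constructor
  · rintro ⟨g, rfl⟩
    obtain ⟨ω, hω, h⟩ := exists_circle_of_mem_planeMotions g.2
    exact ⟨ω, hω, funext fun i => h _ _⟩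
  · rintro ⟨ω, hω, h⟩
    obtain ⟨g, hg, hs⟩ := exists_planeMotion hω (q.1 (φ 0)) (p.1 (φ 0))
    refine ⟨g, Subtype.ext (edge_injective φ ?_ hg)⟩
    rw [h]
    exact funext fun i => hs _ _

lemma continuous_toModuli : Continuous (toModuli : P.Config → P.Moduli) := continuous_quotient_mk'

lemma isOpenMap_toModuli : IsOpenMap (toModuli : P.Config → P.Moduli) := by
  have : ContinuousConstSMul planeMotions P.Config := ⟨fun g =>
    Continuous.subtype_mk (continuous_pi fun v =>
      g.1.continuous.comp ((continuous_apply v).comp continuous_subtype_val)) _⟩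
  exact isOpenMap_quotient_mk'_mul

lemma continuous_edge (φ : Fin (k + 1) ≃ V) : Continuous fun p : P.Config => edge φ p.1 := by
  have : ∀ v, Continuous fun p : P.Config => p.1 v := fun v =>
    (continuous_apply v).comp continuous_subtype_val
  exact continuous_pi fun i => (this _).sub (this _)

variable {φ : Fin (k + 1) ≃ V} {ψ : Fin k ≃ E}

lemma theta_toModuli (p : P.Config) :
    theta (φ 0) (φ (Fin.last k)) (toModuli p) = ‖∑ i, edge φ p.1 i‖ := by
  change dist (p.1 (φ 0)) (p.1 (φ (Fin.last k))) = _
  rw [dist_comm, dist_eq_norm]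
  unfold edge
  rw [sum_succ_sub_castSucc fun m => p.1 (φ m)]

lemma isConf_edge (hP : ∀ i : Fin k, P.ends (ψ i) = s(φ i.castSucc, φ i.succ))
    (p : P.Config) : IsConf (fun i => (P.length (ψ i) : ℝ)) (edge φ p.1) :=
  fun i => by
    have h := p.2 _ _ _ (hP i)
    rw [dist_comm, dist_eq_norm] at h
    exact h

/-- The configuration of a path with given edge vectors. -/
def configOfEdges (hP : ∀ i : Fin k, P.ends (ψ i) = s(φ i.castSucc, φ i.succ))
    (e : Fin k → ℂ) (he : IsConf (fun i => (P.length (ψ i) : ℝ)) e) : P.Config :=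
  ⟨ofEdges φ e, fun d u v h => by
    obtain ⟨i, rfl⟩ := ψ.surjective d
    have hi : dist (ofEdges φ e (φ i.succ)) (ofEdges φ e (φ i.castSucc)) = P.length (ψ i) := by
      rw [dist_eq_norm]
      exact (congrArg norm (congrFun (edge_ofEdges φ e) i)).trans (he i)
    rw [hP i] at h
    rcases Sym2.eq_iff.1 h with ⟨rfl, rfl⟩ | ⟨rfl, rfl⟩
    · rw [dist_comm, hi]
    · exact hi⟩

lemma edge_configOfEdges (hP : ∀ i : Fin k, P.ends (ψ i) = s(φ i.castSucc, φ i.succ))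
    (e : Fin k → ℂ) (he : IsConf (fun i => (P.length (ψ i) : ℝ)) e) :
    edge φ (configOfEdges hP e he).1 = e := edge_ofEdges φ e

lemma continuous_configOfEdges (hP : ∀ i : Fin k, P.ends (ψ i) = s(φ i.castSucc, φ i.succ))
    {X : Type*} [TopologicalSpace X] {f : X → Fin k → ℂ}
    (hf : Continuous f) (hc : ∀ t, IsConf (fun i => (P.length (ψ i) : ℝ)) (f t)) :
    Continuous fun t => configOfEdges hP (f t) (hc t) := by
  refine Continuous.subtype_mk (continuous_pi fun v => ?_) _
  unfold ofEdges
  refine continuous_finsetSum _ fun i _ => ?_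
  split_ifs
  · exact (continuous_apply i).comp hf
  · exact continuous_const

lemma distSet_eq_ran (hP : ∀ i : Fin k, P.ends (ψ i) = s(φ i.castSucc, φ i.succ)) :
    P.distSet (φ 0) (φ (Fin.last k)) =
    ran (fun i => (P.length (ψ i) : ℝ)) Finset.univ := by
  ext x
  constructor
  · rintro ⟨m, rfl⟩
    obtain ⟨p, rfl⟩ := Quotient.exists_rep m
    exact ⟨_, isConf_edge hP p, (theta_toModuli p).symm⟩
  · rintro ⟨e, he, rfl⟩
    refine ⟨toModuli (configOfEdges hP e he), ?_⟩
    rw [theta_toModuli, edge_configOfEdges]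

/-- The end-to-end distance of a collinear configuration is a critical value. -/
lemma isCriticalValue_of_collinear
    (hP : ∀ i : Fin k, P.ends (ψ i) = s(φ i.castSucc, φ i.succ))
    (hpos : ∀ d, 0 < P.length d) {c : Fin k → ℝ}
    (hc : ∀ i, |c i| = P.length (ψ i)) :
    P.IsCriticalValue (φ 0) (φ (Fin.last k)) |∑ i, c i| := by
  have he : IsConf (fun i => (P.length (ψ i) : ℝ)) fun i => (c i : ℂ) := fun i => by
    rw [Complex.norm_real, Real.norm_eq_abs, hc i]
  have hθ : theta (φ 0) (φ (Fin.last k)) (toModuli (configOfEdges hP _ he)) = |∑ i, c i| := by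
    rw [theta_toModuli, edge_configOfEdges, ← Complex.ofReal_sum, Complex.norm_real,
      Real.norm_eq_abs]
  refine ⟨toModuli (configOfEdges hP _ he), ?_, hθ⟩
  by_cases h0 : ∑ i, c i = 0
  · left
    rw [hθ, h0, abs_zero]
  right
  intro γ hγ hγ0
  obtain ⟨ω, hω, hγω⟩ := (toModuli_eq_iff φ _ _).1 hγ0
  rw [edge_configOfEdges] at hγω
  have hd : ∀ i, DifferentiableAt ℝ (fun τ => edge φ (γ τ).1 i) 0 := fun i =>
    (((hγ _).differentiable (by simp)) 0).sub (((hγ _).differentiable (by simp)) 0)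
  have hci : ∀ i, c i ≠ 0 := fun i => abs_pos.1 (by rw [hc i]; exact hpos _)
  set D : Fin k → ℂ := fun i => deriv (fun τ => edge φ (γ τ).1 i) 0 with hD
  -- Edges of constant length move orthogonally to themselves, hence to the common direction `ω`; so
  -- the end-to-end vector, parallel to `ω`, has a velocity orthogonal to itself.
  have hDi : ∀ i, inner ℝ ω (D i) = 0 := by
    intro i
    have h1 := (hd i).hasDerivAt.norm_sq
    have h2 : (fun τ => ‖edge φ (γ τ).1 i‖ ^ 2) = fun _ => (P.length (ψ i) : ℝ) ^ 2 :=
      funext fun τ => by rw [isConf_edge hP (γ τ) i]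
    rw [h2] at h1
    have h3 := h1.unique (hasDerivAt_const _ _)
    have h4 : edge φ (γ 0).1 i = c i • ω := by
      rw [hγω]
      simp [mul_comm]
    rw [h4, real_inner_smul_left] at h3
    have h5 : c i * inner ℝ ω (D i) = 0 := by linarith
    exact (mul_eq_zero.1 h5).resolve_left (hci i)
  have hS : HasDerivAt (fun τ => ∑ i, edge φ (γ τ).1 i) (∑ i, D i) 0 :=
    HasDerivAt.fun_sum fun i _ => (hd i).hasDerivAt
  have hS0 : ∑ i, edge φ (γ 0).1 i = (∑ i, c i) • ω := by
    rw [hγω, Finset.sum_smul]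
    exact Finset.sum_congr rfl fun i _ => by simp [mul_comm]
  have hω0 : ω ≠ 0 := norm_pos_iff.1 (by rw [hω]; norm_num)
  have h6 := hS.norm_sq.sqrt (by
    rw [hS0]
    exact pow_ne_zero 2 (norm_ne_zero_iff.2 (smul_ne_zero h0 hω0)))
  have h7 : inner ℝ (∑ i, edge φ (γ 0).1 i) (∑ i, D i) = 0 := by
    rw [hS0, real_inner_smul_left, inner_sum, Finset.sum_eq_zero fun i _ => hDi i, mul_zero]
  rw [h7, mul_zero, zero_div] at h6
  refine h6.congr_of_eventuallyEq (Eventually.of_forall fun τ => ?_)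
  simp only
  rw [theta_toModuli, Real.sqrt_sq (norm_nonneg _)]

/-- Turning one edge onto the real axis makes all of them real. -/
lemma exists_collinear {ι : Type*} [Fintype ι] [Nonempty ι] {l : ι → ℝ} (hl : ∀ j, 0 < l j)
    {e : ι → ℂ} (he : IsConf l e) (h : ∀ i j, (e i * (starRingEnd ℂ) (e j)).im = 0) :
    ∃ c : ι → ℝ, (∀ j, |c j| = l j) ∧ |∑ j, c j| = ‖∑ j, e j‖ := by
  obtain ⟨i⟩ := ‹Nonempty ι›
  have hi : 0 < ‖e i‖ := by rw [he i]; exact hl i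
  have hi' : ((starRingEnd ℂ) (e i)) ≠ 0 := by
    rw [← norm_pos_iff, Complex.norm_conj]; exact hi
  set u : ℂ := (starRingEnd ℂ) (e i) / ‖e i‖ with hu
  have hu1 : ‖u‖ = 1 := by
    rw [hu, norm_div, Complex.norm_conj, Complex.norm_real, norm_norm, div_self hi.ne']
  have hr : ∀ j, e j * u = ((e j * u).re : ℂ) := by
    intro j
    have : (e j * u).im = 0 := by
      rw [hu, ← mul_div_assoc, Complex.div_ofReal_im, h, zero_div]
    exact Complex.ext rfl (by simpa using this)
  refine ⟨fun j => (e j * u).re, fun j => ?_, ?_⟩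
  · rw [← Real.norm_eq_abs, ← Complex.norm_real, ← hr, norm_mul, hu1, mul_one, he j]
  · rw [← Real.norm_eq_abs, ← Complex.norm_real, Complex.ofReal_sum,
      ← Finset.sum_congr rfl fun j _ => hr j, ← Finset.sum_mul, norm_mul, hu1, mul_one]

/-- Over a value with connected fibre that is not attained by collinear configurations, any two
configurations are linked. -/
lemma linked_of_isPreconnected [Nonempty (Fin k)]
    (hP : ∀ i : Fin k, P.ends (ψ i) = s(φ i.castSucc, φ i.succ))
    (hpos : ∀ d, 0 < P.length d) {x : ℝ}
    (hx : IsPreconnected {m : P.Moduli | theta (φ 0) (φ (Fin.last k)) m = x})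
    (hnc : ∀ c : Fin k → ℝ, (∀ i, |c i| = P.length (ψ i)) → |∑ i, c i| ≠ x) {e e' : Fin k → ℂ}
    (he : IsConf (fun i => (P.length (ψ i) : ℝ)) e)
    (he' : IsConf (fun i => (P.length (ψ i) : ℝ)) e') (hex : ‖∑ i, e i‖ = x)
    (hex' : ‖∑ i, e' i‖ = x) : Linked (fun i => (P.length (ψ i) : ℝ)) x e e' := by
  set l : Fin k → ℝ := fun i => (P.length (ψ i) : ℝ) with hldef
  have hl : ∀ j, 0 < l j := fun j => hpos (ψ j)
  -- Quantifying over all representatives makes the relation well defined on classes; it passes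
  -- between representatives because `Linked` tolerates rotations on both sides.
  set R : P.Moduli → P.Moduli → Prop := fun m m' => ∀ p p' : P.Config, toModuli p = m →
    toModuli p' = m' → Linked l x (edge φ p.1) (edge φ p'.1) with hR
  have key := hx.induction₂ R (fun m hm => ?_) (fun m₁ m₂ m₃ _ h₂ _ h12 h23 => ?_)
    (fun m m' _ _ h p p' hp hp' => (h p' p hp' hp).symm) (x := toModuli (configOfEdges hP e he))
    (y := toModuli (configOfEdges hP e' he')) ?_ ?_
  · have := key _ _ rfl rfl
    rwa [edge_configOfEdges, edge_configOfEdges] at this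
  · obtain ⟨p, rfl⟩ := Quotient.exists_rep m
    have hpx : ‖∑ i, edge φ p.1 i‖ = x := (theta_toModuli p).symm.trans hm
    obtain ⟨i, j, hij⟩ : ∃ i j, (edge φ p.1 i * (starRingEnd ℂ) (edge φ p.1 j)).im ≠ 0 := by
      by_contra! h
      obtain ⟨c, hc, hcx⟩ := exists_collinear hl (isConf_edge hP p) h
      exact hnc c hc (hcx.trans hpx)
    have hev := eventually_linked hl (isConf_edge hP p) hij
    rw [hpx] at hev
    have hev' : ∀ᶠ q : P.Config in 𝓝 p, Linked l x (edge φ p.1) (edge φ q.1) :=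
      (continuous_edge φ).continuousAt.eventually hev
    have himg := isOpenMap_toModuli.image_mem_nhds hev'
    refine mem_nhdsWithin_of_mem_nhds (mem_of_superset himg ?_)
    rintro _ ⟨q, hq, rfl⟩ p₁ q₁ hp₁ hq₁
    obtain ⟨ω, hω, h1⟩ := (toModuli_eq_iff φ p₁ p).1 hp₁
    obtain ⟨ω', hω', h2⟩ := (toModuli_eq_iff φ q₁ q).1 hq₁
    rw [h1, h2]
    exact ((hq.smul_right hω').symm.smul_right hω).symm
  · intro p₁ p₃ h₁ h₃
    obtain ⟨p₂, rfl⟩ := Quotient.exists_rep m₂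
    have hpx : ‖∑ i, edge φ p₂.1 i‖ = x := (theta_toModuli p₂).symm.trans h₂
    have := Linked.trans hl (isConf_edge hP p₂) (e₁ := edge φ p₁.1) (e₃ := edge φ p₃.1)
    rw [hpx] at this
    exact this (h12 p₁ p₂ h₁ rfl) (h23 p₂ p₃ rfl h₃)
  · change theta _ _ _ = x
    rw [theta_toModuli, edge_configOfEdges, hex]
  · change theta _ _ _ = x
    rw [theta_toModuli, edge_configOfEdges, hex']

end Path

end Linkage

/-! ### The lifting theorem -/

open Linkage

theorem mainTheorem3 {V E : Type*} (P : Linkage V E) (k : ℕ) (hk : 2 ≤ k) (s t : V)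
    (hP : P.IsPath k s t) (hpos : ∀ e : E, 0 < P.length e)
    (p q : P.Moduli)
    (hp : ¬ P.IsCriticalValue s t (Linkage.theta s t p))
    (hq : ¬ P.IsCriticalValue s t (Linkage.theta s t q))
    (α : unitInterval → P.distSet s t) (hα : Continuous α)
    (hα0 : (α 0 : ℝ) = Linkage.theta s t p) (hα1 : (α 1 : ℝ) = Linkage.theta s t q)
    (hmeet : (Set.range (fun u => (α u : ℝ)) ∩ P.nabla s t).Nonempty) :
    ∃ lift : unitInterval → P.Moduli, Continuous lift ∧ lift 0 = p ∧ lift 1 = q ∧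
      ∀ u, Linkage.theta s t (lift u) = α u := by
  obtain ⟨φ, ψ, hends, rfl, rfl⟩ := hP
  obtain ⟨p, rfl⟩ := Quotient.exists_rep p
  obtain ⟨q, rfl⟩ := Quotient.exists_rep q
  change (α 0 : ℝ) = theta _ _ (toModuli p) at hα0
  change (α 1 : ℝ) = theta _ _ (toModuli q) at hα1
  change ¬ P.IsCriticalValue _ _ (theta _ _ (toModuli p)) at hp
  change ¬ P.IsCriticalValue _ _ (theta _ _ (toModuli q)) at hq
  have : Nonempty (Fin k) := ⟨⟨0, by omega⟩⟩
  set l : Fin k → ℝ := fun i => (P.length (ψ i) : ℝ) with hldef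
  have hl : ∀ j, 0 < l j := fun j => hpos (ψ j)
  set β : ℝ → ℝ := fun x => (α (Set.projIcc 0 1 zero_le_one x) : ℝ) with hβ
  have hβc : Continuous β := continuous_subtype_val.comp (hα.comp continuous_projIcc)
  have hβα : ∀ u : unitInterval, β u = α u := fun u => by
    simp only [hβ]
    rw [Set.projIcc_val]
  have hβr : ∀ x, β x ∈ ran l Finset.univ := fun x => by
    rw [← distSet_eq_ran hends]; exact (α _).2
  have hpβ : ‖∑ i, edge φ p.1 i‖ = β 0 := by
    rw [← theta_toModuli, ← hα0]; exact (hβα 0).symm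
  have hqβ : ‖∑ i, edge φ q.1 i‖ = β 1 := by
    rw [← theta_toModuli, ← hα1]; exact (hβα 1).symm
  have hpc : IsConf l (edge φ p.1) := isConf_edge hends p
  have hqc : IsConf l (edge φ q.1) := isConf_edge hends q
  have hne : (Finset.univ : Finset (Fin k)).Nonempty := Finset.univ_nonempty
  suffices h : ∃ ω : ℂ, ‖ω‖ = 1 ∧
      Joins l Finset.univ β 0 (edge φ p.1) 1 (ω • edge φ q.1) by
    obtain ⟨ω, hω, f, hf, hf0, hf1⟩ := h
    refine ⟨fun u => toModuli (configOfEdges hends (f u) (hf.conf u)),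
      continuous_toModuli.comp (continuous_configOfEdges hends (f := fun u : unitInterval => f u)
        (hf.cont.comp continuous_subtype_val) fun u => hf.conf u), ?_, ?_, fun u => ?_⟩
    · refine (toModuli_eq_iff φ _ p).2 ⟨1, norm_one, ?_⟩
      rw [edge_configOfEdges, one_smul]
      exact hf0
    · refine (toModuli_eq_iff φ _ q).2 ⟨ω, hω, ?_⟩
      rw [edge_configOfEdges]
      exact hf1
    · rw [theta_toModuli, edge_configOfEdges, hf.dist_eq, hβα]
  obtain ⟨x, ⟨u, hux⟩, -, hx⟩ := hmeet
  have hux : β u = x := (hβα u).trans hux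
  by_cases hcol : ∃ c : Fin k → ℝ, (∀ i, |c i| = l i) ∧ |∑ i, c i| = x
  · obtain ⟨c, hc, hcx⟩ := hcol
    have hcrit := isCriticalValue_of_collinear hends hpos hc
    rw [hcx] at hcrit
    -- Steering needs positive time on both sides of `u`; this is where the non-critical end values
    -- enter.
    have hu0 : 0 < (u : ℝ) := by
      refine lt_of_le_of_ne u.2.1 fun h => hp ?_
      rwa [theta_toModuli, hpβ, h, hux]
    have hu1 : (u : ℝ) < 1 := by
      refine lt_of_le_of_ne u.2.2 fun h => hq ?_
      rwa [theta_toModuli, hqβ, ← h, hux]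
    obtain ⟨e₁, ω₁, hω₁, he₁, hj₁⟩ := exists_joins_collinear hl Finset.univ hne hc hβc hβr hu0 hpc
      hpβ (hcx.trans hux.symm)
    obtain ⟨e₂, ω₂, hω₂, he₂, hj₂⟩ := exists_joins_collinear hl Finset.univ hne hc
      (α := fun x => β (-x)) (hβc.comp continuous_neg) (fun x => hβr _)
      (neg_lt_neg hu1) hqc (by rw [neg_neg]; exact hqβ) (by rw [neg_neg]; exact hcx.trans hux.symm)
    have hω₂0 : ω₂ ≠ 0 := norm_pos_iff.1 (by rw [hω₂]; norm_num)
    have hω : ‖ω₁ * ω₂⁻¹‖ = 1 := by rw [norm_mul, norm_inv, hω₁, hω₂]; norm_num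
    have hj₃ := hj₂.symm.rotate hω
    simp only [neg_neg] at hj₃
    -- Both motions arrive at rotated copies of the same collinear chain `c`.
    have : (ω₁ * ω₂⁻¹) • e₂ = e₁ := by
      funext i
      simp only [Pi.smul_apply, smul_eq_mul, he₁ i (Finset.mem_univ i), he₂ i (Finset.mem_univ i)]
      field_simp
    rw [this] at hj₃
    exact ⟨_, hω, hj₁.trans hj₃ hu0.le hu1.le⟩
  · push Not at hcol
    obtain ⟨f, hf, hf0⟩ := exists_isLift hl Finset.univ hne hβc hβr 0 hpc hpβ
    obtain ⟨g, hg, hg1⟩ := exists_isLift hl Finset.univ hne hβc hβr 1 hqc hqβ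
    rw [← hf0, ← hg1]
    refine exists_joins_of_linked hβc hf hg zero_lt_one u.2 ?_
    rw [hux]
    exact linked_of_isPreconnected hends hpos hx.isPreconnected hcol (hf.conf u) (hg.conf u)
      ((hf.dist_eq u).trans hux) ((hg.dist_eq u).trans hux)
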